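/- Let $F_4$ be the free group of rank $4$, and let $$G_1=(F_4\times\mathbb Z/2\mathbb Z)\star F_4,\qquad G_2=(F_4\star F_4)\times\mathbb Z/2\mathbb Z ,$$ each with its nine standard generators $u$ (generating $\mathbb Z/2\mathbb Z$), $a_1,\dots,a_4$ and $b_1,\dots,b_4$ (free generators of the first and of the second copy of $F_4$). For a group $G$ generated by $m$ elements, a plain word of length $\ell$ is any sequence of $\ell$ of the $2m$ letters consisting of the generators and their formal inverses, and the gross cogrowth of $G$ is $$\theta(G)=\lim_{\ell\to\infty,\ \ell\ \mathrm{even}}\ \tfrac1\ell\log_{2m}\#\{w \text{ plain word of length }\ell:\ w=e\text{ in }G\}.$$ The random quotient of $G$ at density $d$ and length $\ell$ is $G/\langle R\rangle$, where $R$ consists of $\lfloor(2m)^{d\ell}\rfloor$ uniformly random plain words of length $\ell$ (either chosen independently, or chosen as a uniformly random set of exactly that many words; all assertions below hold for both models), and $\langle R\rangle$ is the normal subgroup generated by $R$. A group with given generators is non-elementary hyperbolic if its word metric is Gromov-hyperbolic and it is neither finite nor quasi-isometric to $\mathbb Z$. A torsion element of a hyperbolic group is harmless if its centralizer is finite or virtually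 $\mathbb Z$, or if it acts trivially on the boundary at infinity. A hyperbolic group has harmless torsion if all its non-trivial torsion elements are harmless, and harmful torsion otherwise. **Proposition.** The group $G_1$ is hyperbolic and has harmful torsion. The limits defining $\theta(G_1)$ and $\theta(G_2)$ exist, $$1-\theta(G_2)=-\log_{18}\frac{1+\sqrt{15}}{9}\approx 0.212\quad(\text{to within }0.0005),\qquad 1-\theta(G_2)<1-\theta(G_1).$$ For every density $d$ with $1-\theta(G_2)<d\le 1$, with probability tending to $1$ as $\ell\to\infty$, the random quotient $G_1/\langle R\rangle$ at density $d$ is trivial if $\ell$ is odd and isomorphic to $\mathbb Z/2\mathbb Z$ if $\ell$ is even. Consequently the following assertion, which is the conclusion of the theorem on random quotients of hyperbolic groups with harmless torsion by plain words, is false for $G=G_1$: "for every $0<d<1$, with probability tending to $1$ as $\ell\to\infty$, the random quotient of $G$ at density $d$ is non-elementary hyperbolic if $d<1-\theta(G)$, and is $\{e\}$ or $\mathbb Z/2\mathbb Z$ if $d>1-\theta(G)$." -/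

import Mathlib

open Filter Topology

namespace RandomQuotient

/-! ### Words, word metric, gross cogrowth -/

/-- The plain (not necessarily reduced) words of length `ℓ` in the `2 * card ι` letters `aᵢ`,
`aᵢ⁻¹`, `i : ι`: the letter `(i, true)` stands for `aᵢ`, and `(i, false)` for the formal inverse
letter `aᵢ⁻¹`. -/
abbrev Word (ι : Type*) (ℓ : ℕ) : Type _ := Fin ℓ → ι × Bool

section MarkedGroup

variable {ι : Type*} {G : Type*} [Group G]

/-- The element of `G` represented by a letter, when `aᵢ` stands for `s i`. -/
def letter (s : ι → G) (x : ι × Bool) : G := if x.2 then s x.1 else (s x.1)⁻¹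

/-- The element of `G` represented by a word. -/
def eval (s : ι → G) {ℓ : ℕ} (w : Word ι ℓ) : G := (List.ofFn fun j => letter s (w j)).prod

/-- The norm of `g`: the smallest length of a word representing `g`
(used only when `s` generates `G`). -/
noncomputable def wordNorm (s : ι → G) (g : G) : ℕ := sInf {n | ∃ w : Word ι n, eval s w = g}

/-- The (left-invariant) word metric, i.e. the path metric on the vertices of the Cayley graph. -/
noncomputable def wordDist (s : ι → G) (x y : G) : ℕ := wordNorm s (x⁻¹ * y)

/-- `θ` is the gross cogrowth of `G` with respect to `s`: the limit over even lengths
`ℓ = 2 n` of `(1 / ℓ) log_{2m} #{w of length ℓ : w = e in G}`, where `m` is the number of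
generators. -/
def HasGrossCogrowth [Fintype ι] (s : ι → G) (θ : ℝ) : Prop :=
  Tendsto
    (fun n : ℕ => 1 / ((2 * n : ℕ) : ℝ) *
      Real.logb ((2 * Fintype.card ι : ℕ) : ℝ)
        (Nat.card {w : Word ι (2 * n) // eval s w = 1} : ℝ))
    atTop (𝓝 θ)

/-! ### Hyperbolicity -/

/-- `G` is generated by the family `s`, and its word metric is hyperbolic in the sense of Gromov
(four-point condition). -/
def IsHyperbolic (s : ι → G) : Prop :=
  Subgroup.closure (Set.range s) = ⊤ ∧
    ∃ δ : ℕ, ∀ x y z t : G,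
      wordDist s x y + wordDist s z t ≤
        max (wordDist s x z + wordDist s y t) (wordDist s x t + wordDist s y z) + 2 * δ

/-- `G`, with its word metric, is quasi-isometric to `ℤ`. -/
def IsQuasiIsometricToInt (s : ι → G) : Prop :=
  ∃ (f : G → ℤ) (A B : ℝ), 1 ≤ A ∧ 0 ≤ B ∧
    (∀ x y : G, (wordDist s x y : ℝ) / A - B ≤ |(f x : ℝ) - f y| ∧
      |(f x : ℝ) - f y| ≤ A * wordDist s x y + B) ∧
    ∀ n : ℤ, ∃ x : G, |(f x : ℝ) - n| ≤ B

/-- Hyperbolic, and neither finite nor quasi-isometric to `ℤ`. -/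
def IsNonElementaryHyperbolic (s : ι → G) : Prop :=
  IsHyperbolic s ∧ Infinite G ∧ ¬ IsQuasiIsometricToInt s

/-! ### Harmless torsion -/

/-- A geodesic ray in the Cayley graph, given by its successive vertices. -/
def IsGeodesicRay (s : ι → G) (r : ℕ → G) : Prop :=
  ∀ i j : ℕ, i ≤ j → wordDist s (r i) (r j) = j - i

/-- Two geodesic rays define the same point of the boundary at infinity. -/
def SameEndpoint (s : ι → G) (r r' : ℕ → G) : Prop :=
  ∃ C : ℕ, ∀ n : ℕ, wordDist s (r n) (r' n) ≤ C

/-- The virtual centre: the elements acting trivially on the boundary at infinity. A point of the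
boundary is the class of a geodesic ray `r`, and `g` maps it to the class of the ray `g r`. -/
def virtualCentre (s : ι → G) : Set G :=
  {g | ∀ r : ℕ → G, IsGeodesicRay s r → SameEndpoint s (fun n => g * r n) r}

/-- `H` has a subgroup of finite index isomorphic to `ℤ`. -/
def IsVirtuallyInt (H : Type*) [Group H] : Prop :=
  ∃ K : Subgroup H, K.FiniteIndex ∧ Nonempty (K ≃* Multiplicative ℤ)

/-- The centralizer of `g` is finite or virtually `ℤ`. -/
def IsStronglyHarmless (g : G) : Prop :=
  Finite (Subgroup.centralizer {g}) ∨ IsVirtuallyInt (Subgroup.centralizer {g})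

/-- Every non-trivial torsion element is strongly harmless or lies in the virtual centre. -/
def HasHarmlessTorsion (s : ι → G) : Prop :=
  ∀ g : G, IsOfFinOrder g → g ≠ 1 → IsStronglyHarmless g ∨ g ∈ virtualCentre s

end MarkedGroup

/-! ### Random quotients by plain words -/

/-- The probability of the event `E` under the uniform law on the finite set `Ω`. -/
noncomputable def uniformProb (Ω : Type*) (E : Ω → Prop) : ℝ :=
  (Nat.card {ω : Ω // E ω} : ℝ) / (Nat.card Ω : ℝ)

/-- The two usual models of a random set of `N` words: choosing `N` times, independently, a
uniform random word, or choosing uniformly a set of exactly `N` words. -/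
inductive Model
  | independent
  | subset

/-- The number of relators at density `d` and length `ℓ`: the integer part of `(2 m) ^ (d ℓ)`. -/
noncomputable def numRelators (ι : Type*) [Fintype ι] (d : ℝ) (ℓ : ℕ) : ℕ :=
  ⌊((2 * Fintype.card ι : ℕ) : ℝ) ^ (d * (ℓ : ℝ))⌋₊

section RandomRelators

variable {ι : Type*} [Fintype ι] {G : Type*} [Group G]

/-- The probability that the set of the elements of `G` represented by the random set of relators
(plain words of length `ℓ`, at density `d`) satisfies `E`. -/
noncomputable def relatorProb (s : ι → G) (d : ℝ) (ℓ : ℕ) (E : Set G → Prop) : Model → ℝ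
  | Model.independent =>
      uniformProb (Fin (numRelators ι d ℓ) → Word ι ℓ)
        (fun R => E (Set.range fun j => eval s (R j)))
  | Model.subset =>
      uniformProb {R : Finset (Word ι ℓ) // R.card = numRelators ι d ℓ}
        (fun R => E (eval s '' (R.1 : Set (Word ι ℓ))))

/-- The quotient `G / ⟨R⟩` by the normal subgroup generated by `R`. -/
abbrev RelQuotient (R : Set G) : Type _ := G ⧸ Subgroup.normalClosure R

/-- The images of the generators in `G / ⟨R⟩`. -/
def quotientGens (s : ι → G) (R : Set G) : ι → RelQuotient R :=
  fun i => QuotientGroup.mk' (Subgroup.normalClosure R) (s i)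

/-- `H` is the trivial group. -/
def IsTrivialGroup (H : Type*) [Group H] : Prop := ∀ h : H, h = 1

/-- `H` is isomorphic to `ℤ/2ℤ`. -/
def IsCyclicTwo (H : Type*) [Group H] : Prop := Nonempty (H ≃* Multiplicative (ZMod 2))

/-- The conclusion of the theorem on random quotients by plain words, for the group `G` generated
by `s`: with `θ` the gross cogrowth, the random quotient at density `d` is, with probability tending
to `1`, non-elementary hyperbolic if `d < 1 - θ`, and `{e}` or `ℤ/2ℤ` if `d > 1 - θ`. -/
def PlainWordsTheoremHolds (s : ι → G) (M : Model) : Prop :=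
  ∀ θ : ℝ, HasGrossCogrowth s θ → ∀ d : ℝ, 0 < d → d < 1 →
    (d < 1 - θ →
      Tendsto
        (fun ℓ : ℕ => relatorProb s d ℓ
          (fun R => IsNonElementaryHyperbolic (quotientGens s R)) M)
        atTop (𝓝 1)) ∧
    (1 - θ < d →
      Tendsto
        (fun ℓ : ℕ => relatorProb s d ℓ
          (fun R => IsTrivialGroup (RelQuotient R) ∨ IsCyclicTwo (RelQuotient R)) M)
        atTop (𝓝 1))

end RandomRelators

/-! ### The two groups -/

/-- The index set of the nine generators `u`, `a₁, …, a₄`, `b₁, …, b₄`. -/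
inductive GenIndex
  | u
  | a (i : Fin 4)
  | b (i : Fin 4)
  deriving Fintype

/-- `(F₄ × ℤ/2ℤ) ⋆ F₄`. -/
abbrev G₁ : Type :=
  Monoid.Coprod (FreeGroup (Fin 4) × Multiplicative (ZMod 2)) (FreeGroup (Fin 4))

/-- `(F₄ ⋆ F₄) × ℤ/2ℤ`. -/
abbrev G₂ : Type :=
  Monoid.Coprod (FreeGroup (Fin 4)) (FreeGroup (Fin 4)) × Multiplicative (ZMod 2)

/-- The standard generators of `G₁`. -/
def gens₁ : GenIndex → G₁
  | GenIndex.u => Monoid.Coprod.inl (1, Multiplicative.ofAdd 1)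
  | GenIndex.a i => Monoid.Coprod.inl (FreeGroup.of i, 1)
  | GenIndex.b i => Monoid.Coprod.inr (FreeGroup.of i)

/-- The standard generators of `G₂`. -/
def gens₂ : GenIndex → G₂
  | GenIndex.u => (1, Multiplicative.ofAdd 1)
  | GenIndex.a i => (Monoid.Coprod.inl (FreeGroup.of i), 1)
  | GenIndex.b i => (Monoid.Coprod.inr (FreeGroup.of i), 1)

end RandomQuotient

open RandomQuotient

/-!
The group `G₁` is a split extension of `ℤ/2ℤ` by a free group: the kernel of the homomorphism that
kills the `aᵢ` and the `bᵢ` is free on the `aᵢ`, the `bᵢ` and the `u bᵢ u`, and every element is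
`u ^ e w` with a unique `w` in that kernel. The coordinates `(e, w)` are constructed as a set on
which `G₁` acts (`permHom`), so that no normal form theorem for free products is needed. Everything
about `G₁` is read off from them.

*Hyperbolicity.* The word norm of `u ^ e w u ^ η` is the length of the reduced word `w` plus the
number of changes in the sequence of flags `e`, those of the letters `u ^ f bᵢ u ^ f` of `w`, and
`η` (`wordNorm_eq_flagCost`). This cost is additive under concatenation up to `2`, so that the
Gromov product of `x` and `y` is, up to a constant, a function of the common suffix of the words of `x⁻¹`
and `y⁻¹`. Two suffixes of one word are nested, which gives the four-point condition.

*Harmful torsion.* The centralizer of `u` contains a free group of rank `4`, and `u` moves the end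
of the ray `bⁿ`.

*Cogrowth.* The number of closed words is supermultiplicative, hence the limits exist. A positive
supersolution of rate `c` for the transition operator bounds the number of closed words of length
`n` by `cⁿ` (`closedCount_le`), and a subsolution of finite support bounds it below
(`le_closedCount`). For `G₂`, words of even length may be projected to the free group of rank `8`,
with `u` as a lazy step. The functions `15 ^ (-|w| / 2)` and
`15 ^ (-|w| / 2) (|w| + 1) (L - |w|)` then give the exact rate `2 + 2 √15`. For `G₁`, an explicit
multiplicative weight in the coordinates `(e, w)` is a supersolution of rate `19 / 2 < 2 + 2 √15`
(`weight_supersolution`).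

*Collapse.* As `10 > 2 + 2 √15`, above the critical density of `G₂` some relators identify each `bᵢ`
with an element spelled by `u` and the `aⱼ`. Then `u` is central and the quotient of `G₁` is one of
`G₂`. There other relators identify each generator with `1` if `ℓ` is odd, and with `u` if `ℓ` is
even (`collapse`). In both models the probability that a given set of words is missed is at most
`(1 - p) ^ N`, where `p` is the proportion of the set and `N` the number of relators
(`tendsto_relatorProb_one`).
-/

namespace RandomQuotient

/-! ### Words and their values -/

section Words

variable {ι : Type*} {G H : Type*} [Group G] [Group H]

lemma map_letter (f : G →* H) (s : ι → G) (x : ι × Bool) :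
    f (letter s x) = letter (fun i => f (s i)) x := by
  unfold letter
  split_ifs <;> simp

lemma map_eval (f : G →* H) (s : ι → G) {n : ℕ} (w : Word ι n) :
    f (eval s w) = eval (fun i => f (s i)) w := by
  simp only [eval, map_list_prod, List.map_ofFn, Function.comp_def, map_letter]

@[simp] lemma eval_zero (s : ι → G) (w : Word ι 0) : eval s w = 1 := by
  simp [eval]

@[simp] lemma eval_cons (s : ι → G) {n : ℕ} (x : ι × Bool) (w : Word ι n) :
    eval s (Fin.cons x w : Word ι (n + 1)) = letter s x * eval s w := by
  simp [eval, List.ofFn_succ]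

@[simp] lemma eval_append (s : ι → G) {m n : ℕ} (v : Word ι m) (w : Word ι n) :
    eval s (Fin.append v w : Word ι (m + n)) = eval s v * eval s w := by
  have : (fun j => letter s ((Fin.append v w : Word ι (m + n)) j)) =
      Fin.append (fun j => letter s (v j)) (fun j => letter s (w j)) := by
    ext j
    refine Fin.addCases (fun i => ?_) (fun i => ?_) j <;> simp
  rw [eval, this, List.ofFn_fin_append, List.prod_append, eval, eval]

lemma eval_eq_pow {s : ι → G} {n : ℕ} {w : Word ι n} {g : G} (h : ∀ j, letter s (w j) = g) :
    eval s w = g ^ n := by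
  simp [eval, h]

/-- `Spells s n g` says that some word of length exactly `n` represents `g`. -/
def Spells (s : ι → G) (n : ℕ) (g : G) : Prop := ∃ w : Word ι n, eval s w = g

lemma Spells.cons {s : ι → G} {n : ℕ} {g : G} (h : Spells s n g) (x : ι × Bool) :
    Spells s (n + 1) (letter s x * g) := by
  obtain ⟨w, rfl⟩ := h
  exact ⟨Fin.cons x w, eval_cons s x w⟩

lemma spells_zero (s : ι → G) : Spells s 0 (1 : G) := ⟨Fin.elim0, eval_zero s _⟩

lemma Spells.wordNorm_le {s : ι → G} {n : ℕ} {g : G} (h : Spells s n g) : wordNorm s g ≤ n :=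
  Nat.sInf_le h

/-- To bound the word norm below, it suffices to bound a quantity that changes by at most one under
left multiplication by a letter. -/
lemma le_wordNorm {s : ι → G} {N : G → ℕ} (h1 : N 1 = 0)
    (hs : ∀ x g, N (letter s x * g) ≤ N g + 1) {g : G} {n : ℕ} (hg : Spells s n g) :
    N g ≤ wordNorm s g := by
  have key : ∀ (n : ℕ) (w : Word ι n), N (eval s w) ≤ n := by
    intro n
    induction n with
    | zero => intro w; simp [h1]
    | succ n ih =>
      intro w
      rw [← Fin.cons_self_tail w, eval_cons]
      exact (hs _ _).trans (by gcongr; exact ih _)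
  obtain ⟨w, hw⟩ := Nat.sInf_mem (s := {n | ∃ w : Word ι n, eval s w = g}) ⟨n, hg⟩
  have := key _ w
  rwa [hw] at this

lemma wordDist_mul_left (s : ι → G) (g x y : G) :
    wordDist s (g * x) (g * y) = wordDist s x y := by
  simp [wordDist, mul_assoc]

end Words

/-! ### Sums over words and sub- and supersolutions -/

section WordSum

variable {ι : Type*} [Fintype ι] {G X : Type*} [Group G] [MulAction G X]

/-- The sum of `f` over the end points of all the trajectories of length `n` that start at `x`. -/
noncomputable def wordSum (s : ι → G) (f : X → ℝ) (n : ℕ) (x : X) : ℝ :=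
  ∑ w : Word ι n, f (eval s w • x)

lemma wordSum_succ (s : ι → G) (f : X → ℝ) (n : ℕ) (x : X) :
    wordSum s f (n + 1) x = ∑ w : Word ι n, ∑ y, f (letter s y • (eval s w • x)) := by
  rw [wordSum, ← (Fin.consEquiv fun _ : Fin (n + 1) => ι × Bool).sum_comp,
    Fintype.sum_prod_type, Finset.sum_comm]
  refine Finset.sum_congr rfl fun w _ => Finset.sum_congr rfl fun y _ => ?_
  rw [← mul_smul, ← eval_cons]
  rfl

lemma wordSum_le {s : ι → G} {f : X → ℝ} {c : ℝ} (hc : 0 ≤ c)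
    (hf : ∀ x, ∑ y, f (letter s y • x) ≤ c * f x) (n : ℕ) (x : X) :
    wordSum s f n x ≤ c ^ n * f x := by
  induction n with
  | zero => simp [wordSum]
  | succ n ih =>
    rw [wordSum_succ]
    calc _ ≤ ∑ w : Word ι n, c * f (eval s w • x) := Finset.sum_le_sum fun w _ => hf _
      _ = c * wordSum s f n x := by rw [wordSum, Finset.mul_sum]
      _ ≤ c * (c ^ n * f x) := by gcongr
      _ = _ := by ring

lemma le_wordSum {s : ι → G} {f : X → ℝ} {c : ℝ} (hc : 0 ≤ c)
    (hf : ∀ x, c * f x ≤ ∑ y, f (letter s y • x)) (n : ℕ) (x : X) :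
    c ^ n * f x ≤ wordSum s f n x := by
  induction n with
  | zero => simp [wordSum]
  | succ n ih =>
    rw [wordSum_succ]
    calc _ = c * (c ^ n * f x) := by ring
      _ ≤ c * wordSum s f n x := by gcongr
      _ = ∑ w : Word ι n, c * f (eval s w • x) := by rw [wordSum, Finset.mul_sum]
      _ ≤ _ := Finset.sum_le_sum fun w _ => hf _

end WordSum

/-! ### Counting the words that represent the identity -/

section ClosedWords

variable {ι : Type*} [Fintype ι] {G : Type*} [Group G]

/-- The number of words of length `n` that represent the identity. -/
noncomputable def closedCount (s : ι → G) (n : ℕ) : ℕ :=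
  Nat.card {w : Word ι n // eval s w = 1}

/-- A nonnegative supersolution of the transition operator bounds the number of closed words: each
of them brings the starting point `x₀` back to itself. -/
lemma closedCount_le {X : Type*} [MulAction G X] {s : ι → G} {f : X → ℝ} {c : ℝ} (hc : 0 ≤ c)
    (hpos : ∀ x, 0 ≤ f x) (hf : ∀ x, ∑ y, f (letter s y • x) ≤ c * f x) {x₀ : X} (h₀ : 0 < f x₀)
    (n : ℕ) : (closedCount s n : ℝ) ≤ c ^ n := by
  classical
  have h := wordSum_le hc hf n x₀
  have h2 : (closedCount s n : ℝ) * f x₀ ≤ wordSum s f n x₀ := by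
    calc (closedCount s n : ℝ) * f x₀
        = ∑ w ∈ (Finset.univ : Finset (Word ι n)).filter (fun w => eval s w = 1),
            f (eval s w • x₀) := by
          rw [closedCount, Nat.card_eq_fintype_card, Fintype.card_subtype, ← nsmul_eq_mul,
            ← Finset.sum_const]
          refine Finset.sum_congr rfl fun w hw => ?_
          rw [(Finset.mem_filter.1 hw).2, one_smul]
      _ ≤ _ := Finset.sum_le_sum_of_subset_of_nonneg (Finset.filter_subset _ _)
          fun w _ _ => hpos _
  exact le_of_mul_le_mul_right (h2.trans h) h₀

/-- A bounded subsolution whose support can be brought back to the identity by words of length `L`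
bounds the number of closed words from below. -/
lemma le_closedCount {s : ι → G} {f : G → ℝ} {c M : ℝ} {L : ℕ} (hc : 0 ≤ c)
    (hf : ∀ x, c * f x ≤ ∑ y, f (letter s y * x)) (hM₀ : 0 ≤ M) (hM : ∀ x, f x ≤ M)
    (hL : ∀ x, 0 < f x → ∃ v : Word ι L, eval s v * x = 1) (n : ℕ) :
    c ^ n * f 1 ≤ M * closedCount s (L + n) := by
  classical
  have h : c ^ n * f 1 ≤ ∑ w : Word ι n, f (eval s w) := by
    have := le_wordSum (s := s) (f := f) hc (by simpa using hf) n 1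
    simpa [wordSum] using this
  -- a word that ends in the support of `f` extends to a closed word, from which it can be recovered
  let S : Finset (Word ι n) := Finset.univ.filter fun w => 0 < f (eval s w)
  have hS : S.card ≤ closedCount s (L + n) := by
    have : ∀ w : S, ∃ v : Word ι L, eval s v * eval s w.1 = 1 := fun w =>
      hL _ (Finset.mem_filter.1 w.2).2
    choose v hv using this
    have hinj : Function.Injective
        (fun w : S => (⟨Fin.append (v w) w.1, by rw [eval_append, hv]⟩ :
          {w : Word ι (L + n) // eval s w = 1})) := by
      intro w w' hw
      have hw := congrArg Subtype.val hw
      simp only at hw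
      ext j : 2
      have := congrFun hw (Fin.natAdd L j)
      simpa using this
    have := Nat.card_le_card_of_injective _ hinj
    simpa [closedCount] using this
  have h3 : ∑ w : Word ι n, f (eval s w) ≤ S.card * M := by
    calc ∑ w : Word ι n, f (eval s w) ≤ ∑ w : Word ι n, if 0 < f (eval s w) then M else 0 := by
          refine Finset.sum_le_sum fun w _ => ?_
          split_ifs with hw
          · exact hM _
          · exact not_lt.1 hw
      _ = _ := by rw [← Finset.sum_filter, Finset.sum_const, nsmul_eq_mul]
  calc _ ≤ _ := h.trans h3
    _ ≤ closedCount s (L + n) * M := by gcongr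
    _ = _ := mul_comm _ _

/-- Closed words stay closed in every image of the group. -/
lemma closedCount_le_of_hom {H : Type*} [Group H] (f : G →* H) (s : ι → G) (n : ℕ) :
    closedCount s n ≤ closedCount (fun i => f (s i)) n :=
  Nat.card_le_card_of_injective
    (fun w => ⟨w.1, by rw [← map_eval, w.2, map_one]⟩) fun w w' h => by
      simpa [Subtype.ext_iff] using h

/-- If a generator is an involution, then there are closed words of every even length. -/
lemma closedCount_pos {s : ι → G} {i : ι} (hi : s i * s i = 1) (n : ℕ) :
    0 < closedCount s (2 * n) := by
  have : Nonempty {w : Word ι (2 * n) // eval s w = 1} :=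
    ⟨fun _ => (i, true), by
      rw [eval_eq_pow (g := s i) fun _ => by simp [letter], pow_mul, pow_two, hi, one_pow]⟩
  exact Nat.card_pos

lemma closedCount_mul_le (s : ι → G) (m n : ℕ) :
    closedCount s m * closedCount s n ≤ closedCount s (m + n) := by
  rw [closedCount, closedCount, ← Nat.card_prod]
  refine Nat.card_le_card_of_injective
    (fun p => ⟨Fin.append p.1.1 p.2.1, by rw [eval_append, p.1.2, p.2.2, one_mul]⟩) ?_
  rintro ⟨⟨v, hv⟩, w, hw⟩ ⟨⟨v', hv'⟩, w', hw'⟩ h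
  have h := congrArg Subtype.val h
  simp only at h
  have h1 : v = v' := by
    ext j : 1
    simpa using congrFun h (Fin.castAdd n j)
  have h2 : w = w' := by
    ext j : 1
    simpa using congrFun h (Fin.natAdd m j)
  subst h1 h2
  rfl

lemma closedCount_le_card (s : ι → G) (n : ℕ) :
    closedCount s n ≤ (2 * Fintype.card ι) ^ n := by
  refine (Nat.card_le_card_of_injective _ Subtype.val_injective).trans ?_
  simp [mul_comm]

/-- The limit defining the gross cogrowth exists by Fekete's lemma, since the number of closed words
is supermultiplicative in the length. -/
lemma exists_hasGrossCogrowth [Nonempty ι] (s : ι → G) (hpos : ∀ n, 0 < closedCount s (2 * n)) :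
    ∃ θ, HasGrossCogrowth s θ := by
  set b : ℝ := ((2 * Fintype.card ι : ℕ) : ℝ) with hb
  have hb1 : 1 < b := by
    have : 0 < Fintype.card ι := Fintype.card_pos
    rw [hb]
    exact_mod_cast (by omega : 1 < 2 * Fintype.card ι)
  let u : ℕ → ℝ := fun n => -Real.logb b (closedCount s (2 * n))
  have hcast : ∀ n, (0 : ℝ) < closedCount s (2 * n) := fun n => by exact_mod_cast hpos n
  have hsub : Subadditive u := by
    intro m n
    have h : (closedCount s (2 * m) : ℝ) * closedCount s (2 * n) ≤
        closedCount s (2 * (m + n)) := by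
      rw [mul_add]
      exact_mod_cast closedCount_mul_le s (2 * m) (2 * n)
    have h2 := Real.logb_le_logb_of_le hb1 (mul_pos (hcast m) (hcast n)) h
    rw [Real.logb_mul (hcast m).ne' (hcast n).ne'] at h2
    simp only [u]
    linarith
  have hbdd : BddBelow (Set.range fun n : ℕ => u n / n) := by
    refine ⟨-2, ?_⟩
    rintro _ ⟨n, rfl⟩
    simp only
    rcases Nat.eq_zero_or_pos n with rfl | hn
    · simp
    have hn' : (0 : ℝ) < n := by exact_mod_cast hn
    rw [le_div_iff₀ hn']
    have h : (closedCount s (2 * n) : ℝ) ≤ b ^ (2 * n) := by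
      rw [hb]
      exact_mod_cast closedCount_le_card s (2 * n)
    have h2 := Real.logb_le_logb_of_le hb1 (hcast n) h
    rw [Real.logb_pow, Real.logb_self_eq_one hb1] at h2
    simp only [u]
    push_cast at h2
    linarith
  refine ⟨-hsub.lim / 2, ?_⟩
  have h := (hsub.tendsto_lim hbdd).neg.div_const 2
  refine h.congr fun n => ?_
  simp only [u, closedCount, ← hb]
  rcases Nat.eq_zero_or_pos n with rfl | hn
  · simp
  push_cast
  field_simp

/-- An exponential upper bound on the number of closed words bounds the gross cogrowth. -/
lemma HasGrossCogrowth.le_logb [Nonempty ι] {s : ι → G} {θ c : ℝ} (h : HasGrossCogrowth s θ)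
    (hpos : ∀ n, 0 < closedCount s (2 * n))
    (hc : ∀ n, (closedCount s (2 * n) : ℝ) ≤ c ^ (2 * n)) :
    θ ≤ Real.logb ((2 * Fintype.card ι : ℕ) : ℝ) c := by
  have hb1 : (1 : ℝ) < ((2 * Fintype.card ι : ℕ) : ℝ) := by
    have : 0 < Fintype.card ι := Fintype.card_pos
    exact_mod_cast (by omega : 1 < 2 * Fintype.card ι)
  refine le_of_tendsto h ((eventually_gt_atTop 0).mono fun n hn => ?_)
  have h2 := Real.logb_le_logb_of_le hb1 (by exact_mod_cast hpos n) (hc n)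
  rw [Real.logb_pow] at h2
  have hn' : (0 : ℝ) < ((2 * n : ℕ) : ℝ) := by exact_mod_cast (by omega : 0 < 2 * n)
  rw [one_div, inv_mul_le_iff₀ hn']
  exact h2

/-- An exponential lower bound on the number of closed words bounds the gross cogrowth. -/
lemma HasGrossCogrowth.logb_le [Nonempty ι] {s : ι → G} {θ c C : ℝ} (h : HasGrossCogrowth s θ)
    (hc : 0 < c) (hC : 0 < C)
    (hle : ∀ᶠ n in atTop, C * c ^ (2 * n) ≤ (closedCount s (2 * n) : ℝ)) :
    Real.logb ((2 * Fintype.card ι : ℕ) : ℝ) c ≤ θ := by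
  set b : ℝ := ((2 * Fintype.card ι : ℕ) : ℝ) with hb
  have hb1 : 1 < b := by
    have : 0 < Fintype.card ι := Fintype.card_pos
    rw [hb]
    exact_mod_cast (by omega : 1 < 2 * Fintype.card ι)
  have hlim : Tendsto (fun n : ℕ => Real.logb b C / ((2 * n : ℕ) : ℝ) + Real.logb b c) atTop
      (𝓝 (0 + Real.logb b c)) := by
    refine Tendsto.add_const _ (Tendsto.div_atTop tendsto_const_nhds ?_)
    exact tendsto_natCast_atTop_atTop.comp (tendsto_id.const_mul_atTop' (by norm_num))
  rw [zero_add] at hlim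
  refine le_of_tendsto_of_tendsto hlim h ?_
  filter_upwards [hle, eventually_gt_atTop 0] with n hn hn0
  have h2 := Real.logb_le_logb_of_le hb1 (by positivity) hn
  rw [Real.logb_mul hC.ne' (by positivity), Real.logb_pow] at h2
  have hn' : (0 : ℝ) < ((2 * n : ℕ) : ℝ) := by exact_mod_cast (by omega : 0 < 2 * n)
  rw [one_div, le_inv_mul_iff₀ hn', mul_add, mul_div_cancel₀ _ hn'.ne']
  exact h2

end ClosedWords

/-! ### Homomorphisms out of the two groups -/

section Lifts

variable {H : Type*} [Group H]

lemma zmod_two_eq : ∀ x : ZMod 2, x = 0 ∨ x = 1 := by decide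

lemma ofAdd_one_mul_self :
    (Multiplicative.ofAdd 1 : Multiplicative (ZMod 2)) * Multiplicative.ofAdd 1 = 1 := rfl

/-- The homomorphism from `ℤ/2ℤ` that sends the generator to the element `g` of square `1`. -/
def involutionHom (g : H) (hg : g * g = 1) : Multiplicative (ZMod 2) →* H where
  toFun z := g ^ (Multiplicative.toAdd z).val
  map_one' := by simp
  map_mul' x y := by
    have h : ∀ x y : ZMod 2, g ^ (x + y).val = g ^ x.val * g ^ y.val := by
      have h1 : (1 : ZMod 2).val = 1 := rfl
      have h2 : (1 + 1 : ZMod 2) = 0 := rfl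
      intro x y
      rcases zmod_two_eq x with rfl | rfl <;> rcases zmod_two_eq y with rfl | rfl <;>
        simp [h1, h2, hg]
    exact h _ _

@[simp] lemma involutionHom_gen (g : H) (hg : g * g = 1) :
    involutionHom g hg (Multiplicative.ofAdd 1) = g := by
  have h1 : (1 : ZMod 2).val = 1 := rfl
  simp [involutionHom, h1]

lemma commute_lift_involutionHom {α : Type*} (f : α → H) (g : H) (hg : g * g = 1)
    (hc : ∀ i, Commute (f i) g) (x : FreeGroup α) (z : Multiplicative (ZMod 2)) :
    Commute (FreeGroup.lift f x) (involutionHom g hg z) := by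
  refine Commute.pow_right ?_ _
  induction x using FreeGroup.induction_on with
  | C1 => simp
  | of i => simpa using hc i
  | inv_of i h => rw [map_inv]; exact h.inv_left
  | mul x y hx hy => rw [map_mul]; exact hx.mul_left hy

/-- The universal property of `G₁`. -/
def lift₁ (s : GenIndex → H) (hu : s .u * s .u = 1) (hc : ∀ i, Commute (s (.a i)) (s .u)) :
    G₁ →* H :=
  Monoid.Coprod.lift
    (MonoidHom.noncommCoprod (FreeGroup.lift fun i => s (.a i)) (involutionHom (s .u) hu)
      (commute_lift_involutionHom _ _ _ hc))
    (FreeGroup.lift fun i => s (.b i))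

@[simp] lemma lift₁_gens₁ (s : GenIndex → H) (hu : s .u * s .u = 1)
    (hc : ∀ i, Commute (s (.a i)) (s .u)) (x : GenIndex) : lift₁ s hu hc (gens₁ x) = s x := by
  cases x <;> simp [lift₁, gens₁]

/-- The universal property of `G₂`. -/
def lift₂ (s : GenIndex → H) (hu : s .u * s .u = 1) (hc : ∀ x, Commute (s x) (s .u)) :
    G₂ →* H :=
  MonoidHom.noncommCoprod
    (Monoid.Coprod.lift (FreeGroup.lift fun i => s (.a i)) (FreeGroup.lift fun i => s (.b i)))
    (involutionHom (s .u) hu)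
    (fun x z => by
      induction x using Monoid.Coprod.induction_on with
      | inl x =>
        rw [Monoid.Coprod.lift_apply_inl]
        exact commute_lift_involutionHom _ _ _ (fun i => hc (.a i)) x z
      | inr x =>
        rw [Monoid.Coprod.lift_apply_inr]
        exact commute_lift_involutionHom _ _ _ (fun i => hc (.b i)) x z
      | mul x y hx hy => rw [map_mul]; exact hx.mul_left hy)

@[simp] lemma lift₂_gens₂ (s : GenIndex → H) (hu : s .u * s .u = 1)
    (hc : ∀ x, Commute (s x) (s .u)) (x : GenIndex) : lift₂ s hu hc (gens₂ x) = s x := by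
  cases x <;> simp [lift₂, gens₂]

end Lifts

lemma gens₁_u_mul_self : gens₁ .u * gens₁ .u = 1 := by
  rw [gens₁, ← map_mul, Prod.mk_mul_mk, ofAdd_one_mul_self]
  exact map_one _

lemma gens₂_u_mul_self : gens₂ .u * gens₂ .u = 1 := by
  rw [gens₂, Prod.mk_mul_mk, ofAdd_one_mul_self]
  simp

lemma commute_gens₁_a_u (i : Fin 4) : Commute (gens₁ (.a i)) (gens₁ .u) := by
  simp only [gens₁, Commute, SemiconjBy, ← map_mul, Prod.mk_mul_mk, one_mul, mul_one]

lemma closure_gens₁ : Subgroup.closure (Set.range gens₁) = ⊤ := by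
  set S := Subgroup.closure (Set.range gens₁)
  have hS : ∀ x, gens₁ x ∈ S := fun x => Subgroup.subset_closure ⟨x, rfl⟩
  have hF : ∀ f : FreeGroup (Fin 4) →* G₁, (∀ i, f (FreeGroup.of i) ∈ S) → ∀ x, f x ∈ S := by
    intro f hf x
    induction x using FreeGroup.induction_on with
    | C1 => simp
    | of i => exact hf i
    | inv_of i h => rw [map_inv]; exact inv_mem h
    | mul x y hx hy => rw [map_mul]; exact mul_mem hx hy
  rw [eq_top_iff]
  intro g _
  induction g using Monoid.Coprod.induction_on with
  | inl x =>
    have hx : x = (x.1, 1) * (1, x.2) := by simp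
    rw [hx, map_mul]
    refine mul_mem (hF (Monoid.Coprod.inl.comp (MonoidHom.inl _ _)) (fun i => hS (.a i)) x.1) ?_
    rcases zmod_two_eq (Multiplicative.toAdd x.2) with h | h
    · rw [(show x.2 = 1 from h), Prod.mk_one_one, map_one]
      exact one_mem _
    · rw [(show x.2 = Multiplicative.ofAdd 1 from h)]
      exact hS .u
  | inr x => exact hF Monoid.Coprod.inr (fun i => hS (.b i)) x
  | mul x y hx hy => exact mul_mem (hx trivial) (hy trivial)

/-! ### The group `G₁` as a split extension of a free group -/

/-- The free generators of the kernel of the homomorphism `G₁ → ℤ/2ℤ` that kills the `aᵢ` and the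
`bᵢ`: the `aᵢ`, and the two conjugates `u ^ e bᵢ u ^ e`, `e = 0, 1`. -/
abbrev KerGen : Type := Fin 4 ⊕ Bool × Fin 4

/-- The element `u ^ e` of `G₁`, with the exponent a Boolean. -/
def uPow (e : Bool) : G₁ := if e then gens₁ .u else 1

@[simp] lemma uPow_false : uPow false = 1 := rfl
@[simp] lemma uPow_true : uPow true = gens₁ .u := rfl
@[simp] lemma uPow_mul_self (e : Bool) : uPow e * uPow e = 1 := by
  cases e <;> simp [gens₁_u_mul_self]
@[simp] lemma uPow_inv (e : Bool) : (uPow e)⁻¹ = uPow e :=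
  inv_eq_of_mul_eq_one_left (uPow_mul_self e)
lemma u_mul_uPow (e : Bool) : gens₁ .u * uPow e = uPow (!e) := by
  cases e <;> simp [gens₁_u_mul_self]
lemma commute_a_uPow (i : Fin 4) (e : Bool) : Commute (gens₁ (.a i)) (uPow e) := by
  cases e
  · exact Commute.one_right _
  · exact commute_gens₁_a_u i

/-- The inclusion of the free subgroup of index two. The letter `inr (e, i)` stands for the
conjugate of `bᵢ` by `u ^ e`. -/
def kerHom : FreeGroup KerGen →* G₁ :=
  FreeGroup.lift fun
    | .inl i => gens₁ (.a i)
    | .inr (e, i) => uPow e * gens₁ (.b i) * uPow e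

/-- The permutation of `Bool × FreeGroup KerGen` by which a generator of `G₁` acts from the left
when `(e, w)` stands for the element `u ^ e w`. -/
def genPerm : GenIndex → Equiv.Perm (Bool × FreeGroup KerGen)
  | .u => Equiv.prodCongrLeft fun _ => Equiv.boolNot
  | .a i => Equiv.prodCongrRight fun _ => Equiv.mulLeft (FreeGroup.of (.inl i))
  | .b i => Equiv.prodCongrRight fun e => Equiv.mulLeft (FreeGroup.of (.inr (e, i)))

/-- The left regular action of `G₁` in the coordinates `(e, w) ↦ u ^ e w`. -/
def permHom : G₁ →* Equiv.Perm (Bool × FreeGroup KerGen) :=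
  lift₁ genPerm (by ext ⟨e, w⟩ <;> simp [genPerm]) (fun i => by
    ext ⟨e, w⟩ <;> simp [genPerm])

@[simp] lemma permHom_gens₁ (x : GenIndex) : permHom (gens₁ x) = genPerm x := lift₁_gens₁ _ _ _ x

lemma permHom_letter_u (b e : Bool) (w : FreeGroup KerGen) :
    permHom (letter gens₁ (.u, b)) (e, w) = (!e, w) := by
  rw [map_letter]
  cases b
  · simp only [letter, permHom_gens₁, Bool.false_eq_true, if_false]
    rw [Equiv.Perm.inv_eq_iff_eq]
    simp [genPerm]
  · simp [letter, genPerm]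

lemma permHom_letter_a (i : Fin 4) (b e : Bool) (w : FreeGroup KerGen) :
    permHom (letter gens₁ (.a i, b)) (e, w) = (e, FreeGroup.mk [(.inl i, b)] * w) := by
  rw [map_letter]
  cases b
  · simp only [letter, permHom_gens₁, Bool.false_eq_true, if_false]
    rw [Equiv.Perm.inv_eq_iff_eq]
    exact Prod.ext rfl (mul_inv_cancel_left (FreeGroup.of (Sum.inl i)) w).symm
  · rfl

lemma permHom_letter_b (i : Fin 4) (b e : Bool) (w : FreeGroup KerGen) :
    permHom (letter gens₁ (.b i, b)) (e, w) = (e, FreeGroup.mk [(.inr (e, i), b)] * w) := by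
  rw [map_letter]
  cases b
  · simp only [letter, permHom_gens₁, Bool.false_eq_true, if_false]
    rw [Equiv.Perm.inv_eq_iff_eq]
    exact Prod.ext rfl (mul_inv_cancel_left (FreeGroup.of (Sum.inr (e, i))) w).symm
  · rfl

/-- The element `u ^ e w` of `G₁`. -/
def ofCoord (p : Bool × FreeGroup KerGen) : G₁ := uPow p.1 * kerHom p.2

lemma ofCoord_genPerm (x : GenIndex) (p : Bool × FreeGroup KerGen) :
    ofCoord (genPerm x p) = gens₁ x * ofCoord p := by
  obtain ⟨e, w⟩ := p
  cases x with
  | u =>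
    change uPow (!e) * kerHom w = _
    rw [← u_mul_uPow, mul_assoc]
    rfl
  | a i =>
    change uPow e * kerHom (FreeGroup.of (.inl i) * w) = _ * (uPow e * kerHom w)
    rw [map_mul, ← mul_assoc, ← mul_assoc, (commute_a_uPow i e).eq]
    simp [kerHom]
  | b i =>
    change uPow e * kerHom (FreeGroup.of (.inr (e, i)) * w) = _ * (uPow e * kerHom w)
    rw [map_mul, ← mul_assoc, ← mul_assoc]
    congr 1
    simp [kerHom, ← mul_assoc]

lemma ofCoord_permHom (g : G₁) (p : Bool × FreeGroup KerGen) :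
    ofCoord (permHom g p) = g * ofCoord p := by
  have hg : g ∈ Subgroup.closure (Set.range gens₁) := by rw [closure_gens₁]; trivial
  induction hg using Subgroup.closure_induction generalizing p with
  | mem g hg =>
    obtain ⟨x, rfl⟩ := hg
    rw [permHom_gens₁, ofCoord_genPerm]
  | one => simp
  | mul g h _ _ hg hh => rw [map_mul, Equiv.Perm.mul_apply, hg, hh, mul_assoc]
  | inv g _ hg =>
    have := hg (permHom g⁻¹ p)
    rw [← Equiv.Perm.mul_apply, ← map_mul, mul_inv_cancel, map_one, Equiv.Perm.one_apply] at this
    rw [this, inv_mul_cancel_left]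

lemma permHom_uPow (f e : Bool) (w : FreeGroup KerGen) :
    permHom (uPow f) (e, w) = (xor f e, w) := by
  cases f <;> simp [genPerm]

/-- On the coordinates with flag `0`, the free subgroup acts by left multiplication. -/
lemma permHom_kerHom (w v : FreeGroup KerGen) : permHom (kerHom w) (false, v) = (false, w * v) := by
  induction w using FreeGroup.induction_on generalizing v with
  | C1 => simp
  | of k =>
    rcases k with i | ⟨e, i⟩
    · simp [kerHom, genPerm]
    · have : kerHom (FreeGroup.of (Sum.inr (e, i))) = uPow e * gens₁ (.b i) * uPow e := by
        simp [kerHom]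
      simp only [this, map_mul, Equiv.Perm.mul_apply, permHom_uPow, permHom_gens₁]
      simp [genPerm, permHom_uPow]
  | inv_of k h =>
    rw [map_inv, map_inv, Equiv.Perm.inv_eq_iff_eq]
    have := h ((FreeGroup.of k)⁻¹ * v)
    rw [mul_inv_cancel_left] at this
    exact this.symm
  | mul x y hx hy => rw [map_mul, map_mul, Equiv.Perm.mul_apply, hy, hx, mul_assoc]

/-- With the base point `(f, 1)`, the action recovers `e` and `w` from `u ^ e w u ^ f`. -/
lemma permHom_ofCoord_mul_uPow (e f : Bool) (w : FreeGroup KerGen) :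
    permHom (uPow e * kerHom w * uPow f) (f, 1) = (e, w) := by
  simp [permHom_uPow, permHom_kerHom]

/-- The point to which `g` moves the base point `(0, 1)` gives coordinates of `g`: every element of
`G₁` has the form `u ^ e w` with `w` in the free subgroup. -/
lemma exists_ofCoord (g : G₁) : ∃ p, ofCoord p = g :=
  ⟨permHom g (false, 1), by rw [ofCoord_permHom]; simp [ofCoord]⟩

/-! ### Left multiplication by a letter on reduced words -/

/-- Left multiplication of a reduced word by a letter: cancel the head, or put the letter in
front. -/
def push {α : Type*} [DecidableEq α] (x : α × Bool) (l : List (α × Bool)) : List (α × Bool) :=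
  if l.head? = some (x.1, !x.2) then l.tail else x :: l

lemma toWord_mk_singleton_mul {α : Type*} [DecidableEq α] (x : α × Bool) (w : FreeGroup α) :
    (FreeGroup.mk [x] * w).toWord = push x w.toWord := by
  rw [FreeGroup.toWord_mul, FreeGroup.toWord_mk, FreeGroup.reduce_singleton, List.singleton_append,
    FreeGroup.reduce.cons, FreeGroup.reduce_toWord, push]
  rcases w.toWord with _ | ⟨y, t⟩
  · simp
  · obtain ⟨x1, x2⟩ := x
    obtain ⟨y1, y2⟩ := y
    simp only [List.head?_cons, Option.some.injEq, Prod.mk.injEq, List.tail_cons]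
    by_cases h : x1 = y1 ∧ x2 = !y2
    · rw [if_pos h, if_pos ⟨h.1.symm, by simp [h.2]⟩]
    · rw [if_neg h, if_neg]
      rintro ⟨rfl, rfl⟩
      simp at h

/-! ### The word norm of `G₁` -/

/-- The number of letters needed to spell `u ^ e l u ^ η` in `G₁`, for a word `l` in the kernel
letters: one for each letter of `l`, and one `u` for each change in the sequence of flags that
consists of `e`, the flags of the letters `u ^ f bᵢ u ^ f` of `l`, and `η`. -/
def flagCost (η : Bool) : Bool → List (KerGen × Bool) → ℕ
  | e, [] => if e = η then 0 else 1
  | e, (.inl _, _) :: l => flagCost η e l + 1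
  | e, (.inr (f, _), _) :: l => flagCost η f l + 1 + if e = f then 0 else 1

lemma length_le_flagCost (η e : Bool) (l : List (KerGen × Bool)) : l.length ≤ flagCost η e l := by
  induction l generalizing e with
  | nil => simp
  | cons x l ih =>
    rcases x with ⟨_ | ⟨f, _⟩, _⟩ <;> simp only [flagCost, List.length_cons]
    · linarith [ih e]
    · linarith [ih f, Nat.zero_le (if e = f then 0 else 1)]

lemma flagCost_start_le (η e f : Bool) (l : List (KerGen × Bool)) :
    flagCost η e l ≤ flagCost η f l + if e = f then 0 else 1 := by
  induction l generalizing e f with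
  | nil => cases η <;> cases e <;> cases f <;> simp [flagCost]
  | cons x l ih =>
    rcases x with ⟨_ | ⟨g, _⟩, _⟩ <;> simp only [flagCost]
    · linarith [ih e f]
    · have h : ∀ e f g : Bool, (if e = g then 0 else 1) ≤
        (if f = g then 0 else 1) + (if e = f then 0 else 1) := by decide
      linarith [h e f g]

/-- Cutting a word in two, with any flag `m` at the cut, does not lower the cost; by
`le_flagCost_append` it adds at most one change on either side. -/
lemma flagCost_append_le (η e m : Bool) (l l' : List (KerGen × Bool)) :
    flagCost η e (l ++ l') ≤ flagCost m e l + flagCost η m l' := by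
  induction l generalizing e with
  | nil =>
    have := flagCost_start_le η e m l'
    simp only [List.nil_append, flagCost]
    omega
  | cons x l ih =>
    rcases x with ⟨_ | ⟨f, _⟩, _⟩ <;> simp only [flagCost, List.cons_append]
    · linarith [ih e]
    · linarith [ih f]

lemma le_flagCost_append (η e m : Bool) (l l' : List (KerGen × Bool)) :
    flagCost m e l + flagCost η m l' ≤ flagCost η e (l ++ l') + 2 := by
  induction l generalizing e with
  | nil =>
    have := flagCost_start_le η m e l'
    simp only [List.nil_append, flagCost]
    split_ifs at this ⊢ <;> omega
  | cons x l ih =>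
    rcases x with ⟨_ | ⟨f, _⟩, _⟩ <;> simp only [flagCost, List.cons_append]
    · linarith [ih e]
    · linarith [ih f]

lemma flagCost_concat_inl (η e : Bool) (l : List (KerGen × Bool)) (i : Fin 4) (b : Bool) :
    flagCost η e (l ++ [(.inl i, b)]) = flagCost η e l + 1 := by
  induction l generalizing e with
  | nil => simp [flagCost]
  | cons x l ih =>
    rcases x with ⟨_ | ⟨f, _⟩, _⟩ <;> simp only [flagCost, List.cons_append, ih]
    omega

lemma flagCost_concat_inr (η e f : Bool) (l : List (KerGen × Bool)) (i : Fin 4) (b : Bool) :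
    flagCost η e (l ++ [(.inr (f, i), b)]) = flagCost f e l + 1 + if η = f then 0 else 1 := by
  induction l generalizing e with
  | nil =>
    simp only [flagCost, List.nil_append, eq_comm]
    omega
  | cons x l ih =>
    rcases x with ⟨_ | ⟨f, _⟩, _⟩ <;> simp only [flagCost, List.cons_append, ih] <;> omega

lemma flagCost_invRev (η e : Bool) (l : List (KerGen × Bool)) :
    flagCost η e (FreeGroup.invRev l) = flagCost e η l := by
  induction l generalizing η e with
  | nil => simp [flagCost, eq_comm]
  | cons x l ih =>
    rw [FreeGroup.invRev_cons]
    rcases x with ⟨i | ⟨f, i⟩, b⟩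
    · exact (flagCost_concat_inl η e _ i (!b)).trans (by rw [ih, flagCost])
    · exact (flagCost_concat_inr η e f _ i (!b)).trans (by rw [ih, flagCost])

lemma flagCost_push_inl_le (η e : Bool) (i : Fin 4) (b : Bool) (l : List (KerGen × Bool)) :
    flagCost η e (push (.inl i, b) l) ≤ flagCost η e l + 1 := by
  unfold push
  split_ifs with h
  · obtain ⟨t, rfl⟩ : ∃ t, l = (.inl i, !b) :: t := by
      cases l with
      | nil => simp at h
      | cons x t => exact ⟨t, by simpa using h⟩
    simp only [flagCost, List.tail_cons]
    omega
  · rfl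

lemma flagCost_push_inr_le (η e : Bool) (i : Fin 4) (b : Bool) (l : List (KerGen × Bool)) :
    flagCost η e (push (.inr (e, i), b) l) ≤ flagCost η e l + 1 := by
  unfold push
  split_ifs with h
  · obtain ⟨t, rfl⟩ : ∃ t, l = (.inr (e, i), !b) :: t := by
      cases l with
      | nil => simp at h
      | cons x t => exact ⟨t, by simpa using h⟩
    simp only [flagCost, List.tail_cons]
    omega
  · simp [flagCost]

/-- The upper bound on the word norm: `u ^ e l u ^ η` is spelled by writing a `u` only where the
flag changes. The word `l` need not be reduced. -/
lemma spells_flagCost (η e : Bool) (l : List (KerGen × Bool)) :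
    Spells gens₁ (flagCost η e l) (uPow e * kerHom (FreeGroup.mk l) * uPow η) := by
  have hu : ∀ {e f : Bool} {n : ℕ} {g : G₁}, Spells gens₁ n (uPow f * g) →
      Spells gens₁ (n + if e = f then 0 else 1) (uPow e * g) := by
    intro e f n g h
    split_ifs with hef
    · rw [hef]
      exact h
    · have h2 := h.cons (.u, true)
      obtain rfl : e = !f := by cases e <;> cases f <;> simp_all
      rw [← u_mul_uPow, mul_assoc]
      exact h2
  induction l generalizing e with
  | nil =>
    have h1 : Spells gens₁ 0 (uPow η * uPow η) := by
      rw [uPow_mul_self]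
      exact spells_zero _
    have := hu (e := e) h1
    rw [← FreeGroup.one_eq_mk, map_one, mul_one]
    simpa [flagCost] using this
  | cons x l ih =>
    have hx : FreeGroup.mk (x :: l) = FreeGroup.mk [x] * FreeGroup.mk l := by
      rw [FreeGroup.mul_mk, List.singleton_append]
    rw [hx, map_mul]
    rcases x with ⟨i | ⟨f, i⟩, b⟩
    · have h := (ih e).cons (.a i, b)
      have h1 : kerHom (FreeGroup.mk [(Sum.inl i, b)]) = letter gens₁ (.a i, b) := by
        cases b <;> simp [kerHom, letter]
      have h2 : Commute (letter gens₁ (.a i, b)) (uPow e) := by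
        cases b
        · simpa [letter] using (commute_a_uPow i e).inv_left
        · simpa [letter] using commute_a_uPow i e
      rw [h1, ← mul_assoc (uPow e), ← h2.eq]
      simpa only [flagCost, mul_assoc] using h
    · have h := (ih f).cons (.b i, b)
      have h1 : uPow f * kerHom (FreeGroup.mk [(Sum.inr (f, i), b)]) =
          letter gens₁ (.b i, b) * uPow f := by
        cases b <;> simp [kerHom, letter, ← mul_assoc]
      rw [mul_assoc, mul_assoc, flagCost]
      refine hu ?_
      rw [← mul_assoc, h1]
      simpa only [mul_assoc] using h

lemma wordNorm_le_flagCost (η e : Bool) (l : List (KerGen × Bool)) :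
    wordNorm gens₁ (uPow e * kerHom (FreeGroup.mk l) * uPow η) ≤ flagCost η e l :=
  (spells_flagCost η e l).wordNorm_le

/-- The word norm of `G₁` in coordinates. -/
lemma wordNorm_eq_flagCost (η e : Bool) {l : List (KerGen × Bool)} (hl : FreeGroup.IsReduced l) :
    wordNorm gens₁ (uPow e * kerHom (FreeGroup.mk l) * uPow η) = flagCost η e l := by
  refine le_antisymm (wordNorm_le_flagCost η e l) ?_
  -- the flag cost of the coordinates changes by at most one under a letter
  let N : G₁ → ℕ := fun g =>
    flagCost η (permHom g (η, 1)).1 (permHom g (η, 1)).2.toWord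
  have hN : N (uPow e * kerHom (FreeGroup.mk l) * uPow η) = flagCost η e l := by
    simp only [N, permHom_ofCoord_mul_uPow, FreeGroup.toWord_mk, hl.reduce_eq]
  rw [← hN]
  refine le_wordNorm (N := N) (by simp [N, flagCost]) ?_ (spells_flagCost η e l)
  intro x g
  obtain ⟨x, b⟩ := x
  simp only [N, map_mul, Equiv.Perm.mul_apply]
  obtain ⟨f, w⟩ := permHom g (η, 1)
  cases x with
  | u =>
    rw [permHom_letter_u]
    refine (flagCost_start_le η (!f) f _).trans ?_
    simp
  | a i =>
    rw [permHom_letter_a, toWord_mk_singleton_mul]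
    exact flagCost_push_inl_le _ _ _ _ _
  | b i =>
    rw [permHom_letter_b, toWord_mk_singleton_mul]
    exact flagCost_push_inr_le _ _ _ _ _

/-! ### Hyperbolicity of `G₁` -/

lemma exists_common_prefix {α : Type*} (l l' : List α) :
    ∃ p s t, l = p ++ s ∧ l' = p ++ t ∧ ∀ a ∈ s.head?, ∀ b ∈ t.head?, a ≠ b := by
  classical
  induction l generalizing l' with
  | nil => exact ⟨[], [], l', rfl, rfl, by simp⟩
  | cons x l ih =>
    cases l' with
    | nil => exact ⟨[], x :: l, [], rfl, rfl, by simp⟩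
    | cons y l' =>
      by_cases h : x = y
      · obtain ⟨p, s, t, rfl, rfl, hst⟩ := ih l'
        exact ⟨x :: p, s, t, rfl, by rw [h]; rfl, hst⟩
      · exact ⟨[], x :: l, y :: l', rfl, rfl, by simpa using h⟩

/-- After removal of the longest common suffix `p` of two reduced words, the quotient of the two is
reduced as written. -/
lemma exists_common_suffix {α : Type*} {l l' : List (α × Bool)} (hl : FreeGroup.IsReduced l)
    (hl' : FreeGroup.IsReduced l') :
    ∃ p s t, l = s ++ p ∧ l' = t ++ p ∧ FreeGroup.IsReduced (s ++ FreeGroup.invRev t) := by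
  obtain ⟨p, s, t, h1, h2, hst⟩ := exists_common_prefix l.reverse l'.reverse
  have h1' : l = s.reverse ++ p.reverse := by
    rw [← List.reverse_append, ← h1, List.reverse_reverse]
  have h2' : l' = t.reverse ++ p.reverse := by
    rw [← List.reverse_append, ← h2, List.reverse_reverse]
  refine ⟨p.reverse, s.reverse, t.reverse, h1', h2', ?_⟩
  have ht : FreeGroup.IsReduced t.reverse := hl'.infix ⟨[], p.reverse, by simp [h2']⟩
  refine List.isChain_append.2 ⟨hl.infix ⟨[], p.reverse, by simp [h1']⟩, ?_, ?_⟩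
  · classical
    exact FreeGroup.IsReduced.of_reduce_eq (by rw [FreeGroup.reduce_invRev, ht.reduce_eq])
  · intro a ha b hb hab
    have ha' : a ∈ s.head? := by simpa using ha
    have hb' : (b.1, !b.2) ∈ t.head? := by
      cases t with
      | nil => simp [FreeGroup.invRev] at hb
      | cons y t =>
        simp [FreeGroup.invRev] at hb
        simp [← hb]
    have := hst a ha' _ hb'
    obtain ⟨a1, a2⟩ := a
    obtain ⟨b1, b2⟩ := b
    simp only at hab
    subst hab
    cases a2 <;> cases b2 <;> simp_all

/-- The inverse of every element of `G₁` in coordinates, with a reduced word. -/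
lemma exists_inv_coord (x : G₁) : ∃ (e : Bool) (l : List (KerGen × Bool)),
    FreeGroup.IsReduced l ∧ x⁻¹ = uPow e * kerHom (FreeGroup.mk l) := by
  obtain ⟨⟨e, w⟩, h⟩ := exists_ofCoord x⁻¹
  exact ⟨e, w.toWord, FreeGroup.isReduced_toWord, by rw [FreeGroup.mk_toWord]; exact h.symm⟩

/-- Common suffixes cancel in the difference `x⁻¹ y`. -/
lemma inv_mul_eq_of_coord {x y : G₁} {e f : Bool} {s t p : List (KerGen × Bool)}
    (hx : x⁻¹ = uPow e * kerHom (FreeGroup.mk (s ++ p)))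
    (hy : y⁻¹ = uPow f * kerHom (FreeGroup.mk (t ++ p))) :
    x⁻¹ * y = uPow e * kerHom (FreeGroup.mk (s ++ FreeGroup.invRev t)) * uPow f := by
  have hy' : y = (kerHom (FreeGroup.mk (t ++ p)))⁻¹ * uPow f := by
    rw [← inv_inv y, hy, mul_inv_rev, uPow_inv]
  rw [hx, hy', ← FreeGroup.mul_mk, ← FreeGroup.mul_mk, ← FreeGroup.mul_mk, ← FreeGroup.inv_mk]
  simp only [map_mul, map_inv]
  group

lemma wordDist_one_eq_flagCost {x : G₁} {e : Bool} {l : List (KerGen × Bool)}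
    (hl : FreeGroup.IsReduced l) (hx : x⁻¹ = uPow e * kerHom (FreeGroup.mk l)) :
    wordDist gens₁ x 1 = flagCost false e l := by
  rw [← wordNorm_eq_flagCost false e hl, wordDist, hx, mul_one, uPow_false, mul_one]

/-- A common suffix bounds the Gromov product below. -/
lemma wordDist_add_le_of_suffix {x y : G₁} {e f : Bool} {s t p : List (KerGen × Bool)}
    (hs : FreeGroup.IsReduced (s ++ p)) (ht : FreeGroup.IsReduced (t ++ p))
    (hx : x⁻¹ = uPow e * kerHom (FreeGroup.mk (s ++ p)))
    (hy : y⁻¹ = uPow f * kerHom (FreeGroup.mk (t ++ p))) :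
    wordDist gens₁ x y + 2 * flagCost false false p ≤
      wordDist gens₁ x 1 + wordDist gens₁ y 1 + 4 := by
  rw [wordDist_one_eq_flagCost hs hx, wordDist_one_eq_flagCost ht hy, wordDist,
    inv_mul_eq_of_coord hx hy]
  have h1 := wordNorm_le_flagCost f e (s ++ FreeGroup.invRev t)
  have h2 := flagCost_append_le f e false s (FreeGroup.invRev t)
  rw [flagCost_invRev] at h2
  have h3 := le_flagCost_append false e false s p
  have h4 := le_flagCost_append false f false t p
  omega

/-- The longest common suffix bounds the Gromov product above. -/
lemma exists_suffix_wordDist_add_le {x y : G₁} {e f : Bool} {l l' : List (KerGen × Bool)}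
    (hl : FreeGroup.IsReduced l) (hl' : FreeGroup.IsReduced l')
    (hx : x⁻¹ = uPow e * kerHom (FreeGroup.mk l))
    (hy : y⁻¹ = uPow f * kerHom (FreeGroup.mk l')) :
    ∃ p, p <:+ l ∧ p <:+ l' ∧ wordDist gens₁ x 1 + wordDist gens₁ y 1 ≤
      wordDist gens₁ x y + 2 * flagCost false false p + 2 := by
  obtain ⟨p, s, t, rfl, rfl, hst⟩ := exists_common_suffix hl hl'
  refine ⟨p, ⟨s, rfl⟩, ⟨t, rfl⟩, ?_⟩
  rw [wordDist_one_eq_flagCost hl hx, wordDist_one_eq_flagCost hl' hy, wordDist,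
    inv_mul_eq_of_coord hx hy, wordNorm_eq_flagCost f e hst]
  have h2 := le_flagCost_append f e false s (FreeGroup.invRev t)
  rw [flagCost_invRev] at h2
  have h3 := flagCost_append_le false e false s p
  have h4 := flagCost_append_le false f false t p
  omega

/-- The four-point condition with one of the points at the identity. -/
lemma four_point_one (x y z : G₁) :
    wordDist gens₁ x y + wordDist gens₁ z 1 ≤
      max (wordDist gens₁ x z + wordDist gens₁ y 1) (wordDist gens₁ x 1 + wordDist gens₁ y z) +
        2 * 3 := by
  obtain ⟨ex, lx, hlx, hx⟩ := exists_inv_coord x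
  obtain ⟨ey, ly, hly, hy⟩ := exists_inv_coord y
  obtain ⟨ez, lz, hlz, hz⟩ := exists_inv_coord z
  obtain ⟨p, hpx, hpz, hp⟩ := exists_suffix_wordDist_add_le hlx hlz hx hz
  obtain ⟨q, hqy, hqz, hq⟩ := exists_suffix_wordDist_add_le hly hlz hy hz
  -- two suffixes of the word of `z` are nested, so that the shorter one is common to all three
  have key : ∀ r, r <:+ lx → r <:+ ly → wordDist gens₁ x y + 2 * flagCost false false r ≤
      wordDist gens₁ x 1 + wordDist gens₁ y 1 + 4 := by
    rintro r ⟨s, rfl⟩ ⟨t, rfl⟩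
    exact wordDist_add_le_of_suffix hlx hly hx hy
  rcases List.suffix_or_suffix_of_suffix hpz hqz with h | h
  · have := key p hpx (h.trans hqy)
    omega
  · have := key q (h.trans hpx) hqy
    omega

theorem isHyperbolic_gens₁ : IsHyperbolic gens₁ := by
  refine ⟨closure_gens₁, 3, fun x y z t => ?_⟩
  have h := four_point_one (t⁻¹ * x) (t⁻¹ * y) (t⁻¹ * z)
  have h1 : ∀ g, wordDist gens₁ (t⁻¹ * g) 1 = wordDist gens₁ g t := fun g => by
    rw [← inv_mul_cancel t, wordDist_mul_left]
  simpa only [h1, wordDist_mul_left] using h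

/-! ### Harmful torsion in `G₁` -/

/-- The inclusion of the first copy of `F₄`. -/
def inclA : FreeGroup (Fin 4) →* G₁ := Monoid.Coprod.inl.comp (MonoidHom.inl _ _)

lemma inclA_injective : Function.Injective inclA :=
  Monoid.Coprod.inl_injective.comp fun x y h => by simpa using congrArg Prod.fst h

lemma inclA_mem_centralizer (x : FreeGroup (Fin 4)) :
    inclA x ∈ Subgroup.centralizer {gens₁ .u} := by
  rw [Subgroup.mem_centralizer_singleton_iff]
  simp [inclA, gens₁, ← map_mul]

lemma not_commute_pow_of {α : Type*} {i j : α} (hij : i ≠ j) {m n : ℕ} (hm : 0 < m) (hn : 0 < n) :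
    ¬ Commute (FreeGroup.of i ^ m) (FreeGroup.of j ^ n) := by
  classical
  intro h
  have h1 : ∀ (i j : α) (m n : ℕ), i ≠ j → (FreeGroup.of i ^ m * FreeGroup.of j ^ n).toWord =
      List.replicate m (i, true) ++ List.replicate n (j, true) := by
    intro i j m n hij
    rw [FreeGroup.toWord_mul, FreeGroup.toWord_of_pow, FreeGroup.toWord_of_pow]
    refine FreeGroup.IsReduced.reduce_eq (List.isChain_append.2 ⟨?_, ?_, ?_⟩)
    · exact List.isChain_replicate_of_rel _ fun _ => rfl
    · exact List.isChain_replicate_of_rel _ fun _ => rfl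
    · intro a ha b hb hab
      rw [List.eq_of_mem_replicate (List.mem_of_mem_getLast? ha),
        List.eq_of_mem_replicate (List.mem_of_mem_head? hb)]
  have h2 := congrArg FreeGroup.toWord h.eq
  rw [h1 i j m n hij, h1 j i n m hij.symm] at h2
  have h3 := congrArg List.head? h2
  obtain ⟨m, rfl⟩ := Nat.exists_eq_succ_of_ne_zero hm.ne'
  obtain ⟨n, rfl⟩ := Nat.exists_eq_succ_of_ne_zero hn.ne'
  simp [List.replicate_succ, hij] at h3

/-- The centralizer of `u` contains a free group of rank `4`. In a subgroup of finite index some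
powers of two free generators remain, and these do not commute. -/
lemma not_isStronglyHarmless_u : ¬ IsStronglyHarmless (gens₁ .u) := by
  rintro (h | ⟨K, hK, ⟨φ⟩⟩)
  · have hinj : Function.Injective
        (fun x => (⟨inclA x, inclA_mem_centralizer x⟩ : Subgroup.centralizer {gens₁ .u})) :=
      fun x y hxy => inclA_injective (congrArg Subtype.val hxy)
    exact (Finite.of_injective _ hinj).not_infinite inferInstance
  · let c : FreeGroup (Fin 4) →* Subgroup.centralizer {gens₁ .u} :=
      inclA.codRestrict _ inclA_mem_centralizer
    have hc : Function.Injective c := fun x y hxy => inclA_injective (congrArg Subtype.val hxy)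
    have key : ∀ i, ∃ m : ℕ, 0 < m ∧ c (FreeGroup.of i ^ m) ∈ K := by
      intro i
      obtain ⟨m, hm, h⟩ := Subgroup.exists_pow_mem_of_index_ne_zero hK.index_ne_zero
        (c (FreeGroup.of i))
      exact ⟨m, hm, by rw [map_pow]; exact h.2⟩
    obtain ⟨m, hm, h0⟩ := key 0
    obtain ⟨n, hn, h1⟩ := key 1
    refine not_commute_pow_of (by decide : (0 : Fin 4) ≠ 1) hm hn (hc ?_)
    have : (⟨_, h0⟩ : K) * ⟨_, h1⟩ = ⟨_, h1⟩ * ⟨_, h0⟩ :=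
      φ.injective (by rw [map_mul, map_mul, mul_comm])
    rw [map_mul, map_mul]
    exact congrArg Subtype.val this

lemma kerHom_replicate (i : Fin 4) (e b : Bool) (n : ℕ) :
    kerHom (FreeGroup.mk (List.replicate n (.inr (e, i), b))) =
      uPow e * letter gens₁ (.b i, b) ^ n * uPow e := by
  induction n with
  | zero => simp [← FreeGroup.one_eq_mk]
  | succ n ih =>
    rw [List.replicate_succ, ← List.singleton_append, ← FreeGroup.mul_mk, map_mul, ih, pow_succ']
    have : kerHom (FreeGroup.mk [(Sum.inr (e, i), b)]) =
        uPow e * letter gens₁ (.b i, b) * uPow e := by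
      cases b <;> simp [kerHom, letter, mul_assoc]
    rw [this]
    simp only [mul_assoc]
    rw [← mul_assoc (uPow e) (uPow e), uPow_mul_self, one_mul]

lemma flagCost_replicate (i : Fin 4) (b : Bool) (n : ℕ) :
    flagCost false false (List.replicate n (.inr (false, i), b)) = n := by
  induction n with
  | zero => simp [flagCost]
  | succ n ih => simp [List.replicate_succ, flagCost, ih]

/-- The powers of `b` form a geodesic ray whose translate by `u` diverges from it. -/
lemma u_notMem_virtualCentre : gens₁ .u ∉ virtualCentre gens₁ := by
  intro h
  have hray : IsGeodesicRay gens₁ fun n => gens₁ (.b 0) ^ n := by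
    intro i j hij
    have hred : FreeGroup.IsReduced
        (List.replicate (j - i) ((.inr (false, 0), true) : KerGen × Bool)) :=
      List.isChain_replicate_of_rel _ fun _ => rfl
    have h1 := wordNorm_eq_flagCost false false hred
    rw [kerHom_replicate, flagCost_replicate] at h1
    simp only [uPow_false, one_mul, mul_one, letter, if_true] at h1
    rw [wordDist, ← h1]
    congr 1
    rw [inv_mul_eq_iff_eq_mul, ← pow_add, Nat.add_sub_cancel' hij]
  obtain ⟨C, hC⟩ := h _ hray
  have h1 := hC (C + 1)
  have hred : FreeGroup.IsReduced
      (List.replicate (C + 1) ((.inr (true, 0), false) : KerGen × Bool) ++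
        List.replicate (C + 1) (.inr (false, 0), true)) := by
    refine List.isChain_append.2 ⟨?_, ?_, ?_⟩
    · exact List.isChain_replicate_of_rel _ fun _ => rfl
    · exact List.isChain_replicate_of_rel _ fun _ => rfl
    · intro a ha b hb hab
      rw [List.eq_of_mem_replicate (List.mem_of_mem_getLast? ha),
        List.eq_of_mem_replicate (List.mem_of_mem_head? hb)] at hab
      simp at hab
  have h2 := wordNorm_eq_flagCost false true hred
  have h3 := length_le_flagCost false true
    (List.replicate (C + 1) ((.inr (true, 0), false) : KerGen × Bool) ++
        List.replicate (C + 1) (.inr (false, 0), true))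
  rw [← h2, ← FreeGroup.mul_mk, map_mul, kerHom_replicate, kerHom_replicate] at h3
  -- `b⁻ⁿ u bⁿ = u (u b u)⁻ⁿ bⁿ` has at least `2 n` kernel letters
  have h4 : (gens₁ .u * gens₁ (.b 0) ^ (C + 1))⁻¹ * gens₁ (.b 0) ^ (C + 1) =
      uPow true * (uPow true * letter gens₁ (.b 0, false) ^ (C + 1) * uPow true *
        (uPow false * letter gens₁ (.b 0, true) ^ (C + 1) * uPow false)) * uPow false := by
    have hu : (gens₁ .u)⁻¹ = gens₁ .u := uPow_inv true
    simp only [mul_assoc, uPow_true, uPow_false, one_mul, mul_one, mul_inv_rev, hu]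
    rw [← mul_assoc (gens₁ .u) (gens₁ .u), gens₁_u_mul_self, one_mul]
    simp [letter]
  rw [wordDist, h4] at h1
  simp only [List.length_append, List.length_replicate] at h3
  omega

lemma gens₁_u_ne_one : gens₁ .u ≠ 1 := by
  intro h
  have h1 := congrArg permHom h
  rw [permHom_gens₁, map_one] at h1
  have := congrArg Prod.fst (DFunLike.congr_fun h1 (false, 1))
  simp [genPerm] at this

/-- The involution `u` is harmful: its centralizer contains a free group of rank `4`. -/
theorem not_hasHarmlessTorsion_gens₁ : ¬ HasHarmlessTorsion gens₁ := by
  intro h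
  have hfin : IsOfFinOrder (gens₁ .u) :=
    isOfFinOrder_iff_pow_eq_one.2 ⟨2, two_pos, by rw [pow_two, gens₁_u_mul_self]⟩
  rcases h _ hfin gens₁_u_ne_one with h | h
  · exact not_isStronglyHarmless_u h
  · exact u_notMem_virtualCentre h

/-! ### Sums over the letters -/

lemma sum_letters (F : GenIndex × Bool → ℝ) :
    ∑ y, F y = F (.u, true) + F (.u, false) + ∑ p : Fin 4 × Bool, F (.a p.1, p.2) +
      ∑ p : Fin 4 × Bool, F (.b p.1, p.2) := by
  let e : Bool ⊕ (Fin 4 × Bool) ⊕ (Fin 4 × Bool) ≃ GenIndex × Bool :=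
    { toFun := fun
        | .inl b => (.u, b)
        | .inr (.inl p) => (.a p.1, p.2)
        | .inr (.inr p) => (.b p.1, p.2)
      invFun := fun
        | (.u, b) => .inl b
        | (.a i, b) => .inr (.inl (i, b))
        | (.b i, b) => .inr (.inr (i, b))
      left_inv := by rintro (_ | _ | _) <;> rfl
      right_inv := by rintro ⟨_ | _ | _, _⟩ <;> rfl }
  rw [← e.sum_comp, Fintype.sum_sum_type, Fintype.sum_sum_type, Fintype.sum_bool, ← add_assoc]
  rfl

section Push

variable {α κ : Type*} [DecidableEq α] [Fintype κ]

lemma sum_push_of_forall_ne (k : κ → α × Bool) (f : List (α × Bool) → ℝ) {l : List (α × Bool)}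
    (h : ∀ p, l.head? ≠ some ((k p).1, !(k p).2)) {c : ℝ} (hc : ∀ p, f (k p :: l) = c) :
    ∑ p, f (push (k p) l) = Fintype.card κ * c := by
  simp [push, h, hc]

lemma sum_push_of_head (k : κ → α × Bool) (hk : Function.Injective k)
    (f : List (α × Bool) → ℝ) {x : α × Bool} {t : List (α × Bool)} (p₀ : κ)
    (h : k p₀ = (x.1, !x.2)) {c : ℝ} (hc : ∀ p, f (k p :: x :: t) = c) :
    ∑ p, f (push (k p) (x :: t)) = f t + (Fintype.card κ - 1) * c := by
  classical
  rw [← Finset.add_sum_erase _ _ (Finset.mem_univ p₀)]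
  congr 1
  · simp [push, h]
  · have : ∀ p ∈ Finset.univ.erase p₀, f (push (k p) (x :: t)) = c := by
      intro p hp
      have hne : ¬ x = ((k p).1, !(k p).2) := by
        intro hx
        refine (Finset.mem_erase.1 hp).1 (hk ?_)
        rw [h, hx, Bool.not_not]
      simp [push, hne, hc]
    have hcard : 0 < Fintype.card κ := Fintype.card_pos_iff.2 ⟨p₀⟩
    rw [Finset.sum_congr rfl this, Finset.sum_const, Finset.card_erase_of_mem (Finset.mem_univ _),
      Finset.card_univ, nsmul_eq_mul, Nat.cast_sub hcard, Nat.cast_one]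

end Push

/-! ### An upper bound for the cogrowth of `G₁` -/

/-- The weight of a word in the kernel letters: `2/7` for each `a` and `1/4` for each `b`. -/
noncomputable def kerWeight : List (KerGen × Bool) → ℝ
  | [] => 1
  | (.inl _, _) :: l => 2 / 7 * kerWeight l
  | (.inr _, _) :: l => 1 / 4 * kerWeight l

/-- The correction of the weight of `u ^ e l`: it is `2/3` if the flag `e` differs from that of a
letter `u ^ f bᵢ u ^ f` at the head of `l`, and `1` otherwise. -/
noncomputable def headWeight (e : Bool) : List (KerGen × Bool) → ℝ
  | (.inr (f, _), _) :: _ => if e = f then 1 else 2 / 3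
  | _ => 1

lemma kerWeight_pos (l : List (KerGen × Bool)) : 0 < kerWeight l := by
  induction l with
  | nil => simp [kerWeight]
  | cons x l ih => rcases x with ⟨_ | _, _⟩ <;> simp only [kerWeight] <;> positivity

lemma headWeight_pos (e : Bool) (l : List (KerGen × Bool)) : 0 < headWeight e l := by
  unfold headWeight
  split
  · split_ifs <;> norm_num
  · norm_num

lemma headWeight_le_one (e : Bool) (l : List (KerGen × Bool)) : headWeight e l ≤ 1 := by
  unfold headWeight
  split
  · split_ifs <;> norm_num
  · norm_num

/-- The weight is a supersolution of rate `19/2` for the transition operator of `G₁`, written in the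
coordinates `(e, l)`. The worst case is a letter `aᵢ` at the head of `l`, where the outgoing `a`,
the returning `a`, the two letters `u` and the `b` contribute at most `7 * 2/7`, `7/2`, `2` and
`8 * 1/4`. -/
lemma weight_supersolution (e : Bool) (l : List (KerGen × Bool)) :
    2 * (kerWeight l * headWeight (!e) l) +
      ∑ p : Fin 4 × Bool, kerWeight (push (.inl p.1, p.2) l) *
        headWeight e (push (.inl p.1, p.2) l) +
      ∑ p : Fin 4 × Bool, kerWeight (push (.inr (e, p.1), p.2) l) *
        headWeight e (push (.inr (e, p.1), p.2) l) ≤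
    19 / 2 * (kerWeight l * headWeight e l) := by
  have hka : Function.Injective fun p : Fin 4 × Bool => ((.inl p.1, p.2) : KerGen × Bool) := by
    rintro ⟨_, _⟩ ⟨_, _⟩ h
    simpa using h
  have hkb : Function.Injective fun p : Fin 4 × Bool =>
      ((.inr (e, p.1), p.2) : KerGen × Bool) := by
    rintro ⟨_, _⟩ ⟨_, _⟩ h
    simpa using h
  let f : List (KerGen × Bool) → ℝ := fun l => kerWeight l * headWeight e l
  have hfa : ∀ l (p : Fin 4 × Bool), f ((.inl p.1, p.2) :: l) = 2 / 7 * kerWeight l := by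
    intro l p
    simp [f, kerWeight, headWeight]
  have hfb : ∀ l (p : Fin 4 × Bool), f ((.inr (e, p.1), p.2) :: l) = 1 / 4 * kerWeight l := by
    intro l p
    simp [f, kerWeight, headWeight]
  have hf : ∀ l, f l ≤ kerWeight l := fun l =>
    mul_le_of_le_one_right (kerWeight_pos l).le (headWeight_le_one e l)
  have hcard : (Fintype.card (Fin 4 × Bool) : ℝ) = 8 := by simp
  change _ + ∑ p : Fin 4 × Bool, f (push (.inl p.1, p.2) l) +
    ∑ p : Fin 4 × Bool, f (push (.inr (e, p.1), p.2) l) ≤ _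
  rcases l with _ | ⟨⟨i | ⟨g, i⟩, b⟩, t⟩
  · rw [sum_push_of_forall_ne _ f (by simp) (hfa []), sum_push_of_forall_ne _ f (by simp) (hfb []),
      hcard]
    norm_num [kerWeight, headWeight]
  · rw [sum_push_of_head _ hka f (i, !b) rfl (hfa _),
      sum_push_of_forall_ne _ f (by simp) (hfb _), hcard]
    have h0 := kerWeight_pos t
    have h1 := hf t
    simp only [kerWeight, headWeight]
    linarith
  · have h0 := kerWeight_pos t
    have h1 := hf t
    by_cases hg : e = g
    · subst hg
      rw [sum_push_of_forall_ne _ f (by simp) (hfa _), sum_push_of_head _ hkb f (i, !b) rfl (hfb _),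
        hcard]
      simp only [kerWeight, headWeight, Bool.not_eq_self, if_true, if_false]
      linarith
    · rw [sum_push_of_forall_ne _ f (by simp) (hfa _),
        sum_push_of_forall_ne _ f (by simp [Ne.symm hg]) (hfb _), hcard]
      have hg' : (!e) = g := by cases e <;> cases g <;> simp_all
      simp only [kerWeight, headWeight, hg, hg', if_true, if_false]
      linarith

/-- The number of closed words in `G₁` grows at most like `(19/2) ^ n`. -/
lemma closedCount_gens₁_le (n : ℕ) : (closedCount gens₁ n : ℝ) ≤ (19 / 2) ^ n := by
  have h := closedCount_le_of_hom permHom gens₁ n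
  refine le_trans (by exact_mod_cast h) (closedCount_le (X := Bool × FreeGroup KerGen)
    (f := fun p => kerWeight p.2.toWord * headWeight p.1 p.2.toWord) (by norm_num)
    (fun p => (mul_pos (kerWeight_pos _) (headWeight_pos _ _)).le) ?_ (x₀ := (false, 1))
    (mul_pos (kerWeight_pos _) (headWeight_pos _ _)) n)
  rintro ⟨e, w⟩
  rw [sum_letters]
  simp only [← map_letter, Equiv.Perm.smul_def, permHom_letter_u, permHom_letter_a,
    permHom_letter_b, toWord_mk_singleton_mul]
  have := weight_supersolution e w.toWord
  linarith

/-! ### The cogrowth of `G₂` -/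

/-- The images of the generators of `G₂` in the free group of rank `8`; that of `u` is trivial. -/
def freeGens : GenIndex → FreeGroup (Fin 4 ⊕ Fin 4)
  | .u => 1
  | .a i => FreeGroup.of (.inl i)
  | .b i => FreeGroup.of (.inr i)

lemma letter_freeGens_u (b : Bool) : letter freeGens (.u, b) = 1 := by
  cases b <;> simp [letter, freeGens]

lemma letter_freeGens_a (i : Fin 4) (b : Bool) :
    letter freeGens (.a i, b) = FreeGroup.mk [(.inl i, b)] := by
  cases b <;> rfl

lemma letter_freeGens_b (i : Fin 4) (b : Bool) :
    letter freeGens (.b i, b) = FreeGroup.mk [(.inr i, b)] := by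
  cases b <;> rfl

/-- The parity of the length of the words that represent an element of `G₂`. -/
def parity₂ : G₂ →* Multiplicative (ZMod 2) :=
  lift₂ (fun _ => Multiplicative.ofAdd 1) ofAdd_one_mul_self fun _ => Commute.refl _

lemma eval_ofAdd_one {n : ℕ} (w : Word GenIndex n) :
    eval (fun _ : GenIndex => (Multiplicative.ofAdd 1 : Multiplicative (ZMod 2))) w =
      Multiplicative.ofAdd 1 ^ n :=
  eval_eq_pow fun j => by
    unfold letter
    split_ifs <;> rfl

lemma ofAdd_one_pow_two_mul (n : ℕ) :
    (Multiplicative.ofAdd 1 : Multiplicative (ZMod 2)) ^ (2 * n) = 1 := by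
  rw [pow_mul, pow_two, ofAdd_one_mul_self, one_pow]

lemma eq_one_of_parity₂ {x : G₂} (h1 : x.1 = 1) (h2 : parity₂ x = 1) : x = 1 := by
  obtain ⟨x, z⟩ := x
  obtain rfl : x = 1 := h1
  rcases zmod_two_eq (Multiplicative.toAdd z) with h | h
  · rw [(show z = 1 from h)]
    rfl
  · rw [(show z = Multiplicative.ofAdd 1 from h)] at h2
    have h3 : parity₂ (1, Multiplicative.ofAdd 1) = Multiplicative.ofAdd 1 :=
      lift₂_gens₂ _ _ _ GenIndex.u
    rw [h3] at h2
    exact absurd h2 (by decide)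

/-- For words of even length, the value in `G₂` is trivial as soon as it is trivial in the free
group of rank `8`: the number of letters `u` is then even. -/
lemma closedCount_gens₂ (n : ℕ) : closedCount gens₂ (2 * n) = closedCount freeGens (2 * n) := by
  refine le_antisymm ?_ ?_
  · let f : G₂ →* FreeGroup (Fin 4 ⊕ Fin 4) := (Monoid.Coprod.lift
      (FreeGroup.lift fun i => freeGens (.a i)) (FreeGroup.lift fun i => freeGens (.b i))).comp
        (MonoidHom.fst _ _)
    have hf : (fun x => f (gens₂ x)) = freeGens := by
      funext x
      cases x <;> simp [f, gens₂, freeGens]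
    rw [← hf]
    exact closedCount_le_of_hom f gens₂ _
  · let k : FreeGroup (Fin 4 ⊕ Fin 4) →*
        Monoid.Coprod (FreeGroup (Fin 4)) (FreeGroup (Fin 4)) := FreeGroup.lift fun
      | .inl i => Monoid.Coprod.inl (FreeGroup.of i)
      | .inr i => Monoid.Coprod.inr (FreeGroup.of i)
    have hk : (fun x => k (freeGens x)) = fun x => MonoidHom.fst _ _ (gens₂ x) := by
      funext x
      cases x <;> simp [k, gens₂, freeGens]
    refine Nat.card_le_card_of_injective (fun w => ⟨w.1, eq_one_of_parity₂ ?_ ?_⟩)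
      fun w w' h => by simpa [Subtype.ext_iff] using h
    · have := map_eval (MonoidHom.fst _ _) gens₂ w.1
      rw [← hk, ← map_eval, w.2, map_one] at this
      exact this
    · have h1 : (fun x => parity₂ (gens₂ x)) = fun _ => Multiplicative.ofAdd 1 := by
        funext x
        exact lift₂_gens₂ _ _ _ x
      rw [map_eval, h1, eval_ofAdd_one, ofAdd_one_pow_two_mul]

/-- The transition operator of the lazy walk on the free group of rank `8`, on radial functions. -/
lemma sum_letters_radial (h : ℕ → ℝ) (w : FreeGroup (Fin 4 ⊕ Fin 4)) :
    ∑ y, h (letter freeGens y * w).norm =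
      2 * h w.norm + if w.norm = 0 then 16 * h 1 else 15 * h (w.norm + 1) + h (w.norm - 1) := by
  have hsum : ∑ y, h (letter freeGens y * w).norm = 2 * h w.norm +
      ∑ p : (Fin 4 ⊕ Fin 4) × Bool, h (push p w.toWord).length := by
    rw [sum_letters, Fintype.sum_prod_type (α₁ := Fin 4 ⊕ Fin 4), Fintype.sum_sum_type,
      Fintype.sum_prod_type, Fintype.sum_prod_type]
    simp only [letter_freeGens_u, letter_freeGens_a, letter_freeGens_b, one_mul, FreeGroup.norm,
      toWord_mk_singleton_mul]
    ring
  rw [hsum]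
  congr 1
  have hcard : (Fintype.card ((Fin 4 ⊕ Fin 4) × Bool) : ℝ) = 16 := by simp
  unfold FreeGroup.norm
  rcases w.toWord with _ | ⟨x, t⟩
  · have := sum_push_of_forall_ne (fun p : (Fin 4 ⊕ Fin 4) × Bool => p) (fun l => h l.length)
      (l := []) (by simp) (c := h 1) (by simp)
    rw [this, hcard]
    simp
  · have := sum_push_of_head (fun p : (Fin 4 ⊕ Fin 4) × Bool => p) Function.injective_id
      (fun l => h l.length) (x := x) (t := t) (x.1, !x.2) rfl (c := h (t.length + 1 + 1)) (by simp)
    rw [this, hcard]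
    simp
    ring

/-- The function `15 ^ (-|w| / 2)` is a supersolution of rate `2 + 2 √15`: away from the identity
there are `15` outgoing letters and one returning letter. -/
lemma closedCount_freeGens_le (n : ℕ) :
    (closedCount freeGens n : ℝ) ≤ (2 + 2 * √15) ^ n := by
  have h15 : √15 * √15 = 15 := Real.mul_self_sqrt (by norm_num)
  have h0 : 0 < √15 := by positivity
  let h : ℕ → ℝ := fun n => (√15)⁻¹ ^ n
  refine closedCount_le (X := FreeGroup (Fin 4 ⊕ Fin 4)) (f := fun w => h w.norm) (by positivity)
    (fun w => by positivity) ?_ (x₀ := 1) (by simp [h]) n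
  intro w
  have hw := sum_letters_radial h w
  simp only [smul_eq_mul]
  rw [hw]
  rcases hn : w.norm with _ | m
  · simp only [h, if_true, pow_zero, pow_one]
    have : (√15)⁻¹ = √15 / 15 := by field_simp; linarith
    rw [this]
    linarith
  · have h1 : h (m + 1 + 1) = h m / 15 := by
      simp only [h, pow_succ, mul_assoc, ← mul_inv, h15]
      ring
    have h2 : h m = √15 * h (m + 1) := by
      simp only [h, pow_succ]
      field_simp
    simp only [Nat.add_sub_cancel, h1, if_neg (Nat.succ_ne_zero m)]
    rw [h2]
    linarith

/-- The trivial letter `u` pads the words, so that every length from the norm on occurs. -/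
lemma spells_freeGens (n : ℕ) (l : List ((Fin 4 ⊕ Fin 4) × Bool)) (hl : l.length ≤ n) :
    Spells freeGens n (FreeGroup.mk l) := by
  induction n generalizing l with
  | zero =>
    obtain rfl : l = [] := List.length_eq_zero_iff.1 (by omega)
    exact spells_zero _
  | succ n ih =>
    rcases l with _ | ⟨⟨i | i, b⟩, t⟩
    · have := (ih [] (by simp)).cons (.u, true)
      rwa [letter_freeGens_u, one_mul] at this
    · have := (ih t (by simpa using hl)).cons (.a i, b)
      rwa [letter_freeGens_a, FreeGroup.mul_mk] at this
    · have := (ih t (by simpa using hl)).cons (.b i, b)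
      rwa [letter_freeGens_b, FreeGroup.mul_mk] at this

/-- The radial function `15 ^ (-n/2) (n + 1) (L - n)`, supported in the ball of radius `L`, is a
subsolution. The second difference of the parabola is `-2`, at least `-2 / L` times its values
inside the ball, hence the rate `2 + 2 √15 (1 - 1 / L)`. -/
lemma le_closedCount_freeGens {L : ℕ} (hL : 0 < L) (n : ℕ) :
    (2 + 2 * √15 * (1 - 1 / (L : ℝ))) ^ n * L ≤ (L + 1) * L * closedCount freeGens (L + n) := by
  have h15 : √15 * √15 = 15 := Real.mul_self_sqrt (by norm_num)
  have h0 : 0 < √15 := by positivity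
  have hL' : (1 : ℝ) ≤ L := by exact_mod_cast hL
  have hr1 : (√15)⁻¹ ≤ 1 := inv_le_one_of_one_le₀ (by
    rw [Real.one_le_sqrt]
    norm_num)
  have hinv : 1 / (L : ℝ) ≤ 1 := by
    rw [div_le_one (by linarith)]
    exact hL'
  -- truncated subtraction cuts the function off outside the ball
  let h : ℕ → ℝ := fun n => (√15)⁻¹ ^ n * ((n + 1) * ((L - n : ℕ) : ℝ))
  have hh0 : ∀ n, 0 ≤ h n := fun n => by positivity
  have hc : 0 ≤ 2 + 2 * √15 * (1 - 1 / (L : ℝ)) := by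
    have : 0 ≤ 1 - 1 / (L : ℝ) := by linarith
    positivity
  have key := le_closedCount (s := freeGens) (f := fun w => h w.norm)
    (c := 2 + 2 * √15 * (1 - 1 / (L : ℝ))) (M := (L + 1) * L) (L := L) hc ?_ (by positivity) ?_ ?_ n
  · simpa [h] using key
  · intro w
    rw [sum_letters_radial]
    rcases lt_or_ge w.norm L with hlt | hge
    · rcases hn : w.norm with _ | m
      · simp only [h, if_true, pow_zero, pow_one, Nat.cast_zero, zero_add, one_mul, Nat.sub_zero,
          Nat.cast_one]
        rw [Nat.cast_sub (by omega)]
        have : (√15)⁻¹ = √15 / 15 := by field_simp; linarith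
        rw [this, Nat.cast_one]
        have h3 : (2 + 2 * √15 * (1 - 1 / (L : ℝ))) * L = 2 * L + 2 * √15 * (L - 1) := by
          field_simp
        rw [h3]
        have : 0 ≤ √15 * (L - 1) := mul_nonneg h0.le (by linarith)
        linarith
      · rw [hn] at hlt
        -- in terms of `q = 15 ^ (-(m + 1) / 2)` and `k = L - (m + 1)`
        obtain ⟨k, rfl⟩ : ∃ k, L = m + 1 + (k + 1) := ⟨L - m - 2, by omega⟩
        set q : ℝ := (√15)⁻¹ ^ (m + 1) with hq
        have hq0 : 0 ≤ q := by positivity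
        have e1 : h (m + 1) = q * ((m + 2) * (k + 1)) := by
          simp only [h, ← hq, Nat.add_sub_cancel_left]
          push_cast
          ring
        have e2 : 15 * h (m + 1 + 1) = √15 * q * ((m + 3) * k) := by
          have : (m + 1 + (k + 1) - (m + 1 + 1) : ℕ) = k := by omega
          simp only [h, this, pow_succ _ (m + 1), ← hq]
          have : (√15)⁻¹ = √15 / 15 := by field_simp; linarith
          rw [this]
          push_cast
          ring
        have e3 : h m = √15 * q * ((m + 1) * (k + 2)) := by
          have : (m + 1 + (k + 1) - m : ℕ) = k + 2 := by omega
          simp only [h, this, hq, pow_succ]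
          push_cast
          field_simp
        simp only [Nat.add_sub_cancel, if_neg (Nat.succ_ne_zero m), e1, e2, e3]
        have hk : ((m + 1 + (k + 1) : ℕ) : ℝ) = (m : ℝ) + k + 2 := by push_cast; ring
        have hLk : 1 / ((m + 1 + (k + 1) : ℕ) : ℝ) * ((m + 2) * (k + 1)) ≥ 1 := by
          rw [hk, ge_iff_le, one_div, le_inv_mul_iff₀ (by positivity)]
          have : (0 : ℝ) ≤ m * k := by positivity
          nlinarith
        have := mul_le_mul_of_nonneg_left hLk (mul_nonneg h0.le hq0)
        nlinarith
    · have hz : h w.norm = 0 := by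
        simp [h, Nat.sub_eq_zero_of_le hge]
      rw [hz, mul_zero, mul_zero, zero_add]
      split_ifs
      · have := hh0 1
        linarith
      · have := hh0 (w.norm + 1)
        have := hh0 (w.norm - 1)
        linarith
  · intro w
    simp only [h]
    rcases le_or_gt L w.norm with hge | hlt
    · rw [Nat.sub_eq_zero_of_le hge]
      simp only [Nat.cast_zero, mul_zero]
      positivity
    · have h1 : (√15)⁻¹ ^ w.norm ≤ 1 := pow_le_one₀ (by positivity) hr1
      have h2 : (w.norm : ℝ) ≤ L := by exact_mod_cast hlt.le
      have h3 : ((L - w.norm : ℕ) : ℝ) ≤ L := by exact_mod_cast Nat.sub_le _ _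
      calc _ ≤ 1 * ((w.norm + 1) * ((L - w.norm : ℕ) : ℝ)) := by gcongr
        _ ≤ 1 * ((L + 1) * L) := by gcongr
        _ = _ := one_mul _
  · intro w hw
    have hlt : w.norm < L := by
      by_contra hge
      rw [show h w.norm = 0 by simp [h, Nat.sub_eq_zero_of_le (not_lt.1 hge)]] at hw
      exact lt_irrefl _ hw
    obtain ⟨v, hv⟩ := spells_freeGens L (w⁻¹).toWord (by
      have := FreeGroup.norm_inv_eq (x := w)
      unfold FreeGroup.norm at this hlt
      omega)
    exact ⟨v, by rw [hv, FreeGroup.mk_toWord, inv_mul_cancel]⟩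

/-- The number of closed words in `G₂` of even length grows at least like `c ^ n`, for every
`c < 2 + 2 √15`. -/
lemma exists_le_closedCount_gens₂ {c : ℝ} (hc0 : 0 ≤ c) (hc : c < 2 + 2 * √15) :
    ∃ C : ℝ, 0 < C ∧ ∀ᶠ n in atTop, C * c ^ (2 * n) ≤ (closedCount gens₂ (2 * n) : ℝ) := by
  have hlim : Tendsto (fun L : ℕ => 2 + 2 * √15 * (1 - 1 / (L : ℝ))) atTop
      (𝓝 (2 + 2 * √15 * (1 - 0))) :=
    (tendsto_const_nhds.sub tendsto_one_div_atTop_nhds_zero_nat).const_mul _ |>.const_add _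
  rw [sub_zero, mul_one] at hlim
  obtain ⟨L, hL, hL0⟩ := ((hlim.eventually_const_le hc).and (eventually_gt_atTop 0)).exists
  set r : ℝ := 2 + 2 * √15 * (1 - 1 / (L : ℝ)) with hr
  have hL' : (0 : ℝ) < L := by exact_mod_cast hL0
  have hr0 : 0 < r := by
    have : 1 / (L : ℝ) ≤ 1 := by
      rw [div_le_one hL']
      exact_mod_cast hL0
    have : 0 ≤ 2 * √15 * (1 - 1 / (L : ℝ)) := mul_nonneg (by positivity) (by linarith)
    linarith
  refine ⟨1 / ((L + 1) * r ^ L), by positivity, (eventually_ge_atTop L).mono fun n hn => ?_⟩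
  obtain ⟨m, hm⟩ : ∃ m, 2 * n = L + m := ⟨2 * n - L, by omega⟩
  rw [closedCount_gens₂, hm]
  have h := le_closedCount_freeGens hL0 m
  rw [← hr] at h
  have h2 : r ^ m ≤ (L + 1) * closedCount freeGens (L + m) := by
    refine le_of_mul_le_mul_right (h.trans_eq ?_) hL'
    ring
  calc 1 / ((L + 1) * r ^ L) * c ^ (L + m) ≤ 1 / ((L + 1) * r ^ L) * r ^ (L + m) := by gcongr
    _ = r ^ m / (L + 1) := by
      rw [pow_add]
      field_simp
    _ ≤ _ := by
      rw [div_le_iff₀ (by positivity)]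
      linarith

instance : Nonempty GenIndex := ⟨.u⟩

lemma two_mul_card_genIndex : 2 * Fintype.card GenIndex = 18 := rfl

/-- The gross cogrowth of `G₂`. -/
lemma HasGrossCogrowth.eq_logb {θ : ℝ} (h : HasGrossCogrowth gens₂ θ) :
    θ = Real.logb 18 (2 + 2 * √15) := by
  have hcard : ((2 * Fintype.card GenIndex : ℕ) : ℝ) = 18 := by
    rw [two_mul_card_genIndex]
    norm_num
  refine le_antisymm ?_ ?_
  · rw [← hcard]
    refine h.le_logb (closedCount_pos gens₂_u_mul_self) fun n => ?_
    rw [closedCount_gens₂]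
    exact closedCount_freeGens_le _
  · have hlim : Tendsto (fun c => Real.logb 18 c) (𝓝[<] (2 + 2 * √15))
        (𝓝 (Real.logb 18 (2 + 2 * √15))) :=
      ((Real.continuousAt_logb (by positivity)).tendsto).mono_left nhdsWithin_le_nhds
    refine le_of_tendsto hlim ?_
    have h2 : (2 : ℝ) < 2 + 2 * √15 := by
      have : 0 < √15 := by positivity
      linarith
    filter_upwards [Ioo_mem_nhdsLT h2] with c hc
    have hc0 : 0 < c := by linarith [hc.1]
    obtain ⟨C, hC, hle⟩ := exists_le_closedCount_gens₂ hc0.le hc.2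
    have := h.logb_le hc0 hC hle
    rwa [hcard] at this

/-! ### Random sets of words -/

lemma uniformProb_nonneg {Ω : Type*} (E : Ω → Prop) : 0 ≤ uniformProb Ω E := by
  unfold uniformProb
  positivity

section Uniform

variable {Ω : Type*} [Finite Ω]

lemma uniformProb_add_le_one {E E' : Ω → Prop} (h : ∀ ω, E ω → ¬ E' ω) :
    uniformProb Ω E + uniformProb Ω E' ≤ 1 := by
  classical
  have := Fintype.ofFinite Ω
  unfold uniformProb
  rw [← add_div]
  refine div_le_one_of_le₀ ?_ (Nat.cast_nonneg _)
  rw [Nat.card_eq_fintype_card, Nat.card_eq_fintype_card, Nat.card_eq_fintype_card,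
    Fintype.card_subtype, Fintype.card_subtype, ← Nat.cast_add, ← Finset.card_union_of_disjoint]
  · exact_mod_cast Finset.card_le_univ _
  · exact Finset.disjoint_filter.2 fun ω _ => h ω

lemma one_sub_sum_le_uniformProb [Nonempty Ω] {κ : Type*} [Fintype κ] {E : Ω → Prop}
    (B : κ → Ω → Prop) (h : ∀ ω, (∀ k, ¬ B k ω) → E ω) :
    1 - ∑ k, uniformProb Ω (B k) ≤ uniformProb Ω E := by
  classical
  have := Fintype.ofFinite Ω
  have hcard : (0 : ℝ) < Nat.card Ω := by exact_mod_cast Nat.card_pos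
  have hle : Nat.card Ω ≤ Nat.card {ω // E ω} + ∑ k, Nat.card {ω // B k ω} := by
    simp only [Nat.card_eq_fintype_card, Fintype.card_subtype]
    refine le_trans ?_ (add_le_add le_rfl Finset.card_biUnion_le)
    refine le_trans (Finset.card_le_card fun ω _ => ?_) (Finset.card_union_le _ _)
    simp only [Finset.mem_union, Finset.mem_filter, Finset.mem_univ, true_and, Finset.mem_biUnion]
    by_cases hω : ∃ k, B k ω
    · exact .inr hω
    · exact .inl (h ω (not_exists.1 hω))
  unfold uniformProb
  rw [← Finset.sum_div, sub_le_iff_le_add, ← add_div, one_le_div hcard]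
  exact_mod_cast hle

lemma card_not_eq (P : Ω → Prop) :
    (Nat.card {w // ¬ P w} : ℝ) = Nat.card Ω - Nat.card {w // P w} := by
  classical
  have := Fintype.ofFinite Ω
  rw [Nat.card_eq_fintype_card, Nat.card_eq_fintype_card, Nat.card_eq_fintype_card,
    Fintype.card_subtype_compl, Nat.cast_sub (Fintype.card_subtype_le _)]

/-- The probability that `N` independent uniform elements all avoid `P`. -/
lemma uniformProb_forall_not [Nonempty Ω] (P : Ω → Prop) (N : ℕ) :
    uniformProb (Fin N → Ω) (fun R => ∀ j, ¬ P (R j)) =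
      (1 - (Nat.card {w // P w} : ℝ) / Nat.card Ω) ^ N := by
  have hcard : (Nat.card Ω : ℝ) ≠ 0 := by exact_mod_cast Nat.card_pos.ne'
  have h1 : Nat.card {R : Fin N → Ω // ∀ j, ¬ P (R j)} = Nat.card {w // ¬ P w} ^ N := by
    rw [Nat.card_congr (Equiv.subtypePiEquivPi (p := fun _ w => ¬ P w)), Nat.card_fun, Nat.card_fin]
  rw [uniformProb, h1, Nat.card_fun, Nat.card_fin, Nat.cast_pow, Nat.cast_pow, card_not_eq,
    ← div_pow, sub_div, div_self hcard]

lemma descFactorial_mul_pow_le {a b : ℕ} (hab : a ≤ b) (N : ℕ) :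
    a.descFactorial N * b ^ N ≤ a ^ N * b.descFactorial N := by
  induction N with
  | zero => simp
  | succ N ih =>
    rw [Nat.descFactorial_succ, Nat.descFactorial_succ, pow_succ, pow_succ]
    have h : (a - N) * b ≤ a * (b - N) := by
      rw [Nat.sub_mul, Nat.mul_sub]
      have : a * N ≤ N * b := by
        rw [mul_comm]
        gcongr
      omega
    calc (a - N) * a.descFactorial N * (b ^ N * b)
        = ((a - N) * b) * (a.descFactorial N * b ^ N) := by ring
      _ ≤ (a * (b - N)) * (a ^ N * b.descFactorial N) := Nat.mul_le_mul h ih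
      _ = _ := by ring

/-- The probability that a uniform set of `N` elements avoids `P` is at most that for `N`
independent uniform elements. -/
lemma uniformProb_subset_forall_not [Nonempty Ω] (P : Ω → Prop) {N : ℕ} (hN : N ≤ Nat.card Ω) :
    uniformProb {R : Finset Ω // R.card = N} (fun R => ∀ w ∈ R.1, ¬ P w) ≤
      (1 - (Nat.card {w // P w} : ℝ) / Nat.card Ω) ^ N := by
  classical
  have := Fintype.ofFinite Ω
  have hcard : (0 : ℝ) < Nat.card Ω := by exact_mod_cast Nat.card_pos
  set a := Nat.card {w // ¬ P w} with ha
  have hab : a ≤ Nat.card Ω := Nat.card_le_card_of_injective _ Subtype.val_injective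
  have h1 : Nat.card {R : {R : Finset Ω // R.card = N} // ∀ w ∈ R.1, ¬ P w} = a.choose N := by
    rw [Nat.card_congr (Equiv.subtypeSubtypeEquivSubtypeInter (fun R : Finset Ω => R.card = N)
      fun R => ∀ w ∈ R, ¬ P w), ha, Nat.card_eq_fintype_card, Nat.card_eq_fintype_card,
      Fintype.card_subtype, Fintype.card_subtype, ← Finset.card_powersetCard]
    congr 1
    ext R
    simp [Finset.mem_powersetCard, Finset.subset_iff, and_comm]
  have h2 : Nat.card {R : Finset Ω // R.card = N} = (Nat.card Ω).choose N := by
    rw [Nat.card_eq_fintype_card, Fintype.card_finset_len, Nat.card_eq_fintype_card]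
  have h3 : (a.choose N : ℝ) * (Nat.card Ω : ℝ) ^ N ≤ (a : ℝ) ^ N * (Nat.card Ω).choose N := by
    have h := descFactorial_mul_pow_le hab N
    rw [Nat.descFactorial_eq_factorial_mul_choose, Nat.descFactorial_eq_factorial_mul_choose] at h
    have h' : N.factorial * (a.choose N * Nat.card Ω ^ N) ≤
        N.factorial * (a ^ N * (Nat.card Ω).choose N) := by
      calc _ = _ := by ring
        _ ≤ _ := h
        _ = _ := by ring
    exact_mod_cast Nat.le_of_mul_le_mul_left h' N.factorial_pos
  have hpos : (0 : ℝ) < (Nat.card Ω).choose N := by exact_mod_cast Nat.choose_pos hN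
  rw [uniformProb, h1, h2, div_le_iff₀ hpos]
  have h4 : 1 - (Nat.card {w // P w} : ℝ) / Nat.card Ω = a / Nat.card Ω := by
    rw [ha, card_not_eq, sub_div, div_self hcard.ne']
  rw [h4, div_pow, div_mul_eq_mul_div, le_div_iff₀ (by positivity)]
  exact h3

end Uniform

section Relators

variable {ι : Type*} [Fintype ι] {G : Type*} [Group G]

lemma relatorProb_add_le_one (s : ι → G) (d : ℝ) (ℓ : ℕ) {E E' : Set G → Prop}
    (h : ∀ R, E R → ¬ E' R) (M : Model) :
    relatorProb s d ℓ E M + relatorProb s d ℓ E' M ≤ 1 := by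
  cases M <;> exact uniformProb_add_le_one fun _ => h _

lemma card_word (ℓ : ℕ) : Nat.card (Word ι ℓ) = (2 * Fintype.card ι) ^ ℓ := by
  simp [mul_comm]

lemma numRelators_le_card [Nonempty ι] {d : ℝ} (hd : d ≤ 1) (ℓ : ℕ) :
    numRelators ι d ℓ ≤ Nat.card (Word ι ℓ) := by
  have hb : (1 : ℝ) ≤ ((2 * Fintype.card ι : ℕ) : ℝ) := by
    have : 0 < Fintype.card ι := Fintype.card_pos
    exact_mod_cast (by omega : 1 ≤ 2 * Fintype.card ι)
  rw [card_word, numRelators]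
  refine Nat.floor_le_of_le ?_
  rw [Nat.cast_pow, ← Real.rpow_natCast]
  refine Real.rpow_le_rpow_of_exponent_le hb ?_
  have : (0 : ℝ) ≤ ℓ := Nat.cast_nonneg _
  nlinarith

/-- A union bound, valid in both models: an event that happens as soon as the random set of words
meets each of finitely many given sets of words. -/
lemma one_sub_sum_le_relatorProb [Nonempty ι] {κ : Type*} [Fintype κ] (s : ι → G) {d : ℝ}
    (hd : d ≤ 1) (ℓ : ℕ) {E : Set G → Prop} (P : κ → Word ι ℓ → Prop)
    (h : ∀ W : Set (Word ι ℓ), (∀ k, ∃ w ∈ W, P k w) → E (eval s '' W)) (M : Model) :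
    1 - ∑ k, (1 - (Nat.card {w // P k w} : ℝ) / Nat.card (Word ι ℓ)) ^ numRelators ι d ℓ ≤
      relatorProb s d ℓ E M := by
  cases M with
  | independent =>
    simp only [← uniformProb_forall_not]
    refine one_sub_sum_le_uniformProb _ fun R hR => ?_
    have := h (Set.range R) fun k => by
      have := hR k
      push Not at this
      obtain ⟨j, hj⟩ := this
      exact ⟨_, ⟨j, rfl⟩, hj⟩
    rw [← Set.range_comp] at this
    exact this
  | subset =>
    have hN := numRelators_le_card (ι := ι) hd ℓ
    have : Nonempty {R : Finset (Word ι ℓ) // R.card = numRelators ι d ℓ} := by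
      obtain ⟨R, -, hR⟩ := Finset.exists_subset_card_eq
        (s := (Finset.univ : Finset (Word ι ℓ))) (n := numRelators ι d ℓ)
        (by rwa [Finset.card_univ, ← Nat.card_eq_fintype_card])
      exact ⟨R, hR⟩
    refine le_trans (sub_le_sub_left (Finset.sum_le_sum fun k _ =>
      uniformProb_subset_forall_not (P k) hN) 1) ?_
    refine one_sub_sum_le_uniformProb _ fun R hR => h _ fun k => ?_
    have := hR k
    push Not at this
    exact this

/-- If each of finitely many sets of words of length `ℓ` has at least `C c ^ ℓ` elements, where
`c > (2m) ^ (1 - d)`, then at density `d` the random set of words meets all of them with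
probability tending to one. -/
lemma tendsto_relatorProb_one [Nonempty ι] {κ : Type*} [Fintype κ] (s : ι → G) {d c C : ℝ}
    (hd : d ≤ 1) (hC : 0 < C) (hc : ((2 * Fintype.card ι : ℕ) : ℝ) ^ (1 - d) < c) (hd0 : 0 ≤ d)
    {E : ℕ → Set G → Prop} (P : (ℓ : ℕ) → κ → Word ι ℓ → Prop)
    (h : ∀ᶠ ℓ in atTop, ∀ W : Set (Word ι ℓ),
      (∀ k, ∃ w ∈ W, P ℓ k w) → E ℓ (eval s '' W))
    (hP : ∀ᶠ ℓ in atTop, ∀ k, C * c ^ ℓ ≤ (Nat.card {w // P ℓ k w} : ℝ)) (M : Model) :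
    Tendsto (fun ℓ => relatorProb s d ℓ (E ℓ) M) atTop (𝓝 1) := by
  set b : ℝ := ((2 * Fintype.card ι : ℕ) : ℝ) with hb
  have hb1 : 1 < b := by
    have : 0 < Fintype.card ι := Fintype.card_pos
    rw [hb]
    exact_mod_cast (by omega : 1 < 2 * Fintype.card ι)
  have hb0 : 0 < b := by linarith
  have hc0 : 0 < c := (Real.rpow_pos_of_pos hb0 _).trans hc
  let q : ℝ := b ^ d * c / b
  have hq : 1 < q := by
    rw [Real.rpow_sub hb0, Real.rpow_one, div_lt_iff₀ (Real.rpow_pos_of_pos hb0 _)] at hc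
    rw [lt_div_iff₀ hb0]
    linarith
  have hmiss : ∀ᶠ ℓ in atTop, ∀ k,
      (1 - (Nat.card {w // P ℓ k w} : ℝ) / Nat.card (Word ι ℓ)) ^ numRelators ι d ℓ ≤
        Real.exp (-(C / 2 * q ^ ℓ)) := by
    filter_upwards [hP] with ℓ hℓ k
    have hcard : (Nat.card (Word ι ℓ) : ℝ) = b ^ ℓ := by
      rw [card_word, Nat.cast_pow]
    have hx : (Nat.card {w // P ℓ k w} : ℝ) ≤ b ^ ℓ := by
      rw [← hcard]
      exact_mod_cast Nat.card_le_card_of_injective _ Subtype.val_injective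
    have hpos : 0 < b ^ ℓ := by positivity
    have hN : b ^ (d * ℓ) / 2 ≤ numRelators ι d ℓ := by
      have h1 : 1 ≤ b ^ (d * (ℓ : ℝ)) := Real.one_le_rpow hb1.le (by positivity)
      have h2 := Nat.lt_floor_add_one (b ^ (d * (ℓ : ℝ)))
      have h3 : (1 : ℝ) ≤ (⌊b ^ (d * (ℓ : ℝ))⌋₊ : ℝ) := by
        exact_mod_cast (Nat.one_le_floor_iff _).2 h1
      rw [numRelators, ← hb]
      linarith
    set p := (Nat.card {w // P ℓ k w} : ℝ) / b ^ ℓ with hp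
    have hp1 : p ≤ 1 := div_le_one_of_le₀ hx hpos.le
    have hp0 : C * c ^ ℓ / b ^ ℓ ≤ p := by
      rw [hp]
      gcongr
      exact hℓ k
    rw [hcard]
    calc (1 - p) ^ numRelators ι d ℓ ≤ Real.exp (-p) ^ numRelators ι d ℓ :=
          pow_le_pow_left₀ (by linarith) (Real.one_sub_le_exp_neg p) _
      _ = Real.exp (-(numRelators ι d ℓ * p)) := by
          rw [← Real.exp_nat_mul]
          congr 1
          ring
      _ ≤ _ := by
          refine Real.exp_le_exp.2 (neg_le_neg ?_)
          calc C / 2 * q ^ ℓ = b ^ (d * ℓ) / 2 * (C * c ^ ℓ / b ^ ℓ) := by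
                simp only [q]
                rw [Real.rpow_mul hb0.le, Real.rpow_natCast, div_pow, mul_pow]
                ring
            _ ≤ _ := by gcongr
  have hlim : Tendsto (fun ℓ : ℕ => 1 - ∑ _k : κ, Real.exp (-(C / 2 * q ^ ℓ))) atTop
      (𝓝 (1 - ∑ _k : κ, 0)) := by
    refine tendsto_const_nhds.sub (tendsto_finsetSum _ fun _ _ => ?_)
    refine Real.tendsto_exp_neg_atTop_nhds_zero.comp ?_
    exact (tendsto_pow_atTop_atTop_of_one_lt hq).const_mul_atTop (by positivity)
  rw [Finset.sum_const_zero, sub_zero] at hlim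
  refine tendsto_of_tendsto_of_tendsto_of_le_of_le' hlim tendsto_const_nhds ?_ ?_
  · filter_upwards [hmiss, h] with ℓ h1 h2
    exact le_trans (sub_le_sub_left (Finset.sum_le_sum fun k _ => h1 k) 1)
      (one_sub_sum_le_relatorProb s hd ℓ (P ℓ) h2 M)
  · refine Eventually.of_forall fun ℓ => ?_
    have h1 := relatorProb_add_le_one s d ℓ (E := E ℓ) (E' := fun R => ¬ E ℓ R)
      (fun R hR => not_not.2 hR) M
    have h2 : 0 ≤ relatorProb s d ℓ (fun R => ¬ E ℓ R) M := by
      cases M <;> exact uniformProb_nonneg _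
    linarith

end Relators

/-! ### Quotients of `G₁` in which everything collapses -/

/-- The parity of the length of the words that represent an element of `G₁`. -/
def parity₁ : G₁ →* Multiplicative (ZMod 2) :=
  lift₁ (fun _ => Multiplicative.ofAdd 1) ofAdd_one_mul_self fun _ => Commute.refl _

lemma parity₁_eval {n : ℕ} (w : Word GenIndex n) :
    parity₁ (eval gens₁ w) = Multiplicative.ofAdd 1 ^ n := by
  have h1 : (fun x => parity₁ (gens₁ x)) = fun _ => Multiplicative.ofAdd 1 := by
    funext x
    exact lift₁_gens₁ _ _ _ x
  rw [map_eval, h1, eval_ofAdd_one]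

/-- A homomorphism out of `G₁` is determined by the images of the generators. -/
lemma hom_ext₁ {H : Type*} [Group H] {f g : G₁ →* H} (h : ∀ x, f (gens₁ x) = g (gens₁ x)) :
    f = g := by
  refine MonoidHom.eq_of_eqOn_dense closure_gens₁ ?_
  rintro _ ⟨x, rfl⟩
  exact h x

/-- The element of `⟨u⟩` in `G₂` by which a generator has to be multiplied for the product to have
words of length `ℓ`: `u` if `ℓ` is even, `1` if `ℓ` is odd. -/
def parityGen (ℓ : ℕ) : G₂ := if Even ℓ then gens₂ .u else 1

/-- The relators of length `ℓ` that make the quotient collapse: those that identify some `bᵢ` with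
an element that commutes with `u`, and those that identify a generator with `u` or with `1`,
modulo the centrality of `u`. -/
def IsCollapsing (ℓ : ℕ) : Fin 4 ⊕ GenIndex → Word GenIndex ℓ → Prop
  | .inl i, w => ∃ z, Commute z (gens₁ .u) ∧ eval gens₁ w = gens₁ (.b i) * z
  | .inr x, w => eval gens₂ w = gens₂ x * parityGen ℓ

section Collapse

variable {ℓ : ℕ} {W : Set (Word GenIndex ℓ)}

local notation "proj" => QuotientGroup.mk' (Subgroup.normalClosure (eval gens₁ '' W))

lemma proj_eval {w : Word GenIndex ℓ} (hw : w ∈ W) : proj (eval gens₁ w) = 1 :=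
  (QuotientGroup.eq_one_iff _).2 (Subgroup.subset_normalClosure ⟨w, hw, rfl⟩)

lemma proj_u_mul_self : proj (gens₁ .u) * proj (gens₁ .u) = 1 := by
  rw [← map_mul, gens₁_u_mul_self, map_one]

/-- Some relators `bᵢ z`, with `z` in the centralizer of `u`, make `u` central. -/
lemma commute_proj_u (h : ∀ i, ∃ w ∈ W, IsCollapsing ℓ (.inl i) w) (x : GenIndex) :
    Commute (proj (gens₁ x)) (proj (gens₁ .u)) := by
  cases x with
  | u => exact Commute.refl _
  | a i => exact (commute_gens₁_a_u i).map _
  | b i =>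
    obtain ⟨w, hw, z, hz, hwz⟩ := h i
    have h1 := proj_eval hw
    rw [hwz, map_mul] at h1
    rw [eq_inv_of_mul_eq_one_left h1]
    exact (hz.map _).inv_left

/-- Once `u` is central, the quotient is a quotient of `G₂`, in which each generator has been
identified with `u` or with `1`. -/
lemma proj_gens₁ (h : ∀ k, ∃ w ∈ W, IsCollapsing ℓ k w) (x : GenIndex) :
    proj (gens₁ x) = if Even ℓ then proj (gens₁ .u) else 1 := by
  let f : G₂ →* _ := lift₂ (fun x => proj (gens₁ x)) proj_u_mul_self
    (commute_proj_u fun i => h (.inl i))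
  have hf : ∀ x, f (gens₂ x) = proj (gens₁ x) := lift₂_gens₂ _ _ _
  obtain ⟨w, hw, hwx⟩ := h (.inr x)
  have h1 := proj_eval hw
  have h2 : (fun x => proj (gens₁ x)) = fun x => f (gens₂ x) := funext fun x => (hf x).symm
  rw [map_eval, h2, ← map_eval, hwx, map_mul, hf, parityGen] at h1
  split_ifs at h1 ⊢ with he
  · rw [hf] at h1
    rw [eq_inv_of_mul_eq_one_left h1, inv_eq_of_mul_eq_one_left proj_u_mul_self]
  · simpa using h1

lemma collapse (h : ∀ k, ∃ w ∈ W, IsCollapsing ℓ k w) :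
    (Odd ℓ ∧ IsTrivialGroup (RelQuotient (eval gens₁ '' W))) ∨
      (Even ℓ ∧ IsCyclicTwo (RelQuotient (eval gens₁ '' W))) := by
  have hx := proj_gens₁ h
  rcases Nat.even_or_odd ℓ with he | ho
  · refine .inr ⟨he, ?_⟩
    simp only [he, if_true] at hx
    have hker : Subgroup.normalClosure (eval gens₁ '' W) ≤ parity₁.ker := by
      refine Subgroup.normalClosure_le_normal ?_
      rintro _ ⟨w, -, rfl⟩
      obtain ⟨n, hn⟩ := he
      change parity₁ (eval gens₁ w) = 1
      rw [parity₁_eval, hn, ← two_mul, ofAdd_one_pow_two_mul]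
    let φ : RelQuotient (eval gens₁ '' W) →* Multiplicative (ZMod 2) :=
      QuotientGroup.lift _ parity₁ hker
    let ψ : Multiplicative (ZMod 2) →* RelQuotient (eval gens₁ '' W) :=
      involutionHom (proj (gens₁ .u)) proj_u_mul_self
    have hφ : ∀ x, φ (proj (gens₁ x)) = Multiplicative.ofAdd 1 := fun x =>
      (QuotientGroup.lift_mk' _ hker _).trans (lift₁_gens₁ _ _ _ x)
    have hψ : ψ (Multiplicative.ofAdd 1) = proj (gens₁ .u) := involutionHom_gen _ _
    refine ⟨MonoidHom.toMulEquiv φ ψ ?_ ?_⟩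
    · refine QuotientGroup.monoidHom_ext _ (hom_ext₁ fun x => ?_)
      change ψ (φ (proj (gens₁ x))) = proj (gens₁ x)
      rw [hφ, hψ]
      exact (hx x).symm
    · refine MonoidHom.ext fun z => ?_
      rcases zmod_two_eq (Multiplicative.toAdd z) with hz | hz
      · rw [(show z = 1 from hz), map_one, map_one]
      · rw [(show z = Multiplicative.ofAdd 1 from hz)]
        rw [MonoidHom.comp_apply, hψ, hφ]
        rfl
  · refine .inl ⟨ho, fun g => ?_⟩
    simp only [Nat.not_even_iff_odd.2 ho, if_false] at hx
    obtain ⟨g, rfl⟩ := QuotientGroup.mk'_surjective _ g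
    have : proj = (1 : G₁ →* _) := hom_ext₁ fun x => by rw [hx]; rfl
    rw [this]
    rfl

end Collapse

/-! ### Counting the collapsing relators -/

/-- There are at least `10 ^ (ℓ - 1)` relators that identify `bᵢ` with a word in `u` and the
`aⱼ`. -/
lemma ten_pow_le_card_isCollapsing (n : ℕ) (i : Fin 4) :
    10 ^ n ≤ Nat.card {w // IsCollapsing (n + 1) (.inl i) w} := by
  let k : Option (Fin 4) → GenIndex := fun o => o.elim .u .a
  have hk : Function.Injective k := by
    rintro (_ | _) (_ | _) h <;> simp_all [k]
  have hcomm : ∀ v : Word (Option (Fin 4)) n,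
      Commute (eval gens₁ (fun j => (k (v j).1, (v j).2))) (gens₁ .u) := by
    intro v
    refine Commute.list_prod_left _ _ fun g hg => ?_
    obtain ⟨j, rfl⟩ := (List.mem_ofFn' _ _).1 hg
    have h1 : ∀ o, Commute (gens₁ (k o)) (gens₁ .u) := by
      rintro (_ | i)
      · exact Commute.refl _
      · exact commute_gens₁_a_u i
    simp only [letter]
    split_ifs
    exacts [h1 _, (h1 _).inv_left]
  have hcard : Nat.card (Word (Option (Fin 4)) n) = 10 ^ n := by
    rw [card_word]
    rfl
  rw [← hcard]
  refine Nat.card_le_card_of_injective (fun v =>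
    ⟨Fin.cons (.b i, true) fun j => (k (v j).1, (v j).2), _, hcomm v, by
      rw [eval_cons]; rfl⟩) ?_
  intro v v' h
  have h1 := congrArg Subtype.val h
  funext j
  have h2 := congrFun h1 j.succ
  simp only [Fin.cons_succ, Prod.mk.injEq] at h2
  exact Prod.ext (hk h2.1) h2.2

lemma closedCount_le_card_isCollapsing_odd (n : ℕ) (x : GenIndex) :
    closedCount gens₂ (2 * n) ≤ Nat.card {w // IsCollapsing (2 * n + 1) (.inr x) w} := by
  refine Nat.card_le_card_of_injective (fun v => ⟨Fin.cons (x, true) v.1, ?_⟩) ?_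
  · change eval gens₂ _ = gens₂ x * parityGen (2 * n + 1)
    rw [eval_cons, v.2, parityGen, if_neg (by simp)]
    rfl
  · intro v v' h
    refine Subtype.ext (funext fun j => ?_)
    simpa using congrFun (congrArg Subtype.val h) j.succ

lemma closedCount_le_card_isCollapsing_even (n : ℕ) (x : GenIndex) :
    closedCount gens₂ (2 * n) ≤ Nat.card {w // IsCollapsing (2 * n + 1 + 1) (.inr x) w} := by
  refine Nat.card_le_card_of_injective
    (fun v => ⟨Fin.cons (x, true) (Fin.cons (.u, true) v.1), ?_⟩) ?_
  · change eval gens₂ _ = gens₂ x * parityGen (2 * n + 1 + 1)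
    rw [eval_cons, eval_cons, v.2, parityGen, if_pos ⟨n + 1, by omega⟩, mul_one]
    rfl
  · intro v v' h
    refine Subtype.ext (funext fun j => ?_)
    simpa using congrFun (congrArg Subtype.val h) j.succ.succ

/-- Each of the kinds of collapsing relators has at least `C c ^ ℓ` members of length `ℓ`, for every
`c < 2 + 2 √15`. For the first kind this holds because `2 + 2 √15 < 10`. -/
lemma exists_le_card_isCollapsing {c : ℝ} (hc1 : 1 ≤ c) (hc : c < 2 + 2 * √15) :
    ∃ C : ℝ, 0 < C ∧ ∀ᶠ ℓ in atTop, ∀ k,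
      C * c ^ ℓ ≤ (Nat.card {w // IsCollapsing ℓ k w} : ℝ) := by
  have hc0 : 0 < c := by linarith
  have hc10 : c ≤ 10 := by
    have : √15 ≤ 4 := Real.sqrt_le_iff.2 (by norm_num)
    linarith
  obtain ⟨C, hC, hle⟩ := exists_le_closedCount_gens₂ hc0.le hc
  obtain ⟨n₀, hn₀⟩ := eventually_atTop.1 hle
  refine ⟨min 1 C / c ^ 2, by positivity, eventually_atTop.2 ⟨2 * n₀ + 1, fun ℓ hℓ => ?_⟩⟩
  have hC' : min 1 C / c ^ 2 ≤ C / c ^ 2 := by gcongr; exact min_le_right _ _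
  rintro (i | x)
  · obtain ⟨n, rfl⟩ : ∃ n, ℓ = n + 1 := ⟨ℓ - 1, by omega⟩
    calc min 1 C / c ^ 2 * c ^ (n + 1) ≤ 1 / c * c ^ (n + 1) := by
          gcongr
          · exact min_le_left _ _
          · nlinarith
      _ = c ^ n := by
          rw [pow_succ]
          field_simp
      _ ≤ 10 ^ n := by gcongr
      _ ≤ _ := by exact_mod_cast ten_pow_le_card_isCollapsing n i
  · rcases Nat.even_or_odd' ℓ with ⟨n, rfl | rfl⟩
    · obtain ⟨m, rfl⟩ : ∃ m, n = m + 1 := ⟨n - 1, by omega⟩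
      calc min 1 C / c ^ 2 * c ^ (2 * (m + 1)) ≤ C / c ^ 2 * c ^ (2 * (m + 1)) := by gcongr
        _ = C * c ^ (2 * m) := by
          rw [mul_add, pow_add]
          field_simp
        _ ≤ closedCount gens₂ (2 * m) := hn₀ m (by omega)
        _ ≤ _ := by exact_mod_cast closedCount_le_card_isCollapsing_even m x
    · calc min 1 C / c ^ 2 * c ^ (2 * n + 1) ≤ C / c * c ^ (2 * n + 1) := by
            gcongr
            · exact min_le_right _ _
            · nlinarith
        _ = C * c ^ (2 * n) := by
          rw [pow_succ]
          field_simp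
        _ ≤ closedCount gens₂ (2 * n) := hn₀ n (by omega)
        _ ≤ _ := by exact_mod_cast closedCount_le_card_isCollapsing_odd n x

lemma cast_two_mul_card_genIndex : ((2 * Fintype.card GenIndex : ℕ) : ℝ) = 18 := by
  rw [two_mul_card_genIndex]
  norm_num

/-- Above the critical density of `G₂`, the random quotient of `G₁` collapses. -/
theorem tendsto_relatorProb_collapse (M : Model) {d : ℝ}
    (hd : 1 - Real.logb 18 (2 + 2 * √15) < d) (hd0 : 0 ≤ d) (hd1 : d ≤ 1) :
    Tendsto (fun ℓ : ℕ => relatorProb gens₁ d ℓ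
      (fun R => (Odd ℓ ∧ IsTrivialGroup (RelQuotient R)) ∨
        (Even ℓ ∧ IsCyclicTwo (RelQuotient R))) M) atTop (𝓝 1) := by
  have h1 : (18 : ℝ) ^ (1 - d) < 2 + 2 * √15 := by
    rw [← Real.lt_logb_iff_rpow_lt (by norm_num) (by positivity)]
    linarith
  obtain ⟨c, hc1, hc2⟩ := exists_between h1
  have h2 : (1 : ℝ) ≤ 18 ^ (1 - d) := Real.one_le_rpow (by norm_num) (by linarith)
  obtain ⟨C, hC, hle⟩ := exists_le_card_isCollapsing (h2.trans hc1.le) hc2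
  refine tendsto_relatorProb_one gens₁ hd1 hC
    (E := fun ℓ R => (Odd ℓ ∧ IsTrivialGroup (RelQuotient R)) ∨
        (Even ℓ ∧ IsCyclicTwo (RelQuotient R)))
    (by rwa [cast_two_mul_card_genIndex]) hd0 IsCollapsing
    (Eventually.of_forall fun ℓ W hW => collapse hW) hle M

/-! ### The numerical value of the critical density -/

lemma one_sub_logb_eq :
    1 - Real.logb 18 (2 + 2 * √15) = -Real.logb 18 ((1 + √15) / 9) := by
  have h : 2 + 2 * √15 = 18 * ((1 + √15) / 9) := by ring
  rw [h, Real.logb_mul (by norm_num) (by positivity), Real.logb_self_eq_one (by norm_num)]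
  ring

lemma abs_critical_density_sub_lt : |(-Real.logb 18 ((1 + √15) / 9)) - 0.212| < 0.0005 := by
  have hlo : (3.8729 : ℝ) < √15 := Real.lt_sqrt_of_sq_lt (by norm_num)
  have hhi : √15 < 3.873 := (Real.sqrt_lt' (by norm_num)).2 (by norm_num)
  have hlog18 : 0 < Real.log 18 := Real.log_pos (by norm_num)
  set x := (1 + √15) / 9 with hx
  have hx0 : 0 < x := by positivity
  have hx1 : 4.8729 / 9 < x := by rw [hx]; gcongr; linarith
  have hx2 : x < 4.873 / 9 := by rw [hx]; gcongr; linarith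
  -- the bounds amount to `7 / 33 < - log x / log 18 < 17 / 80`
  have h1 : x ^ 33 * 18 ^ 7 < 1 := by
    calc x ^ 33 * 18 ^ 7 < (4.873 / 9) ^ 33 * 18 ^ 7 := by gcongr
      _ < 1 := by norm_num
  have h2 : 1 < x ^ 80 * 18 ^ 17 := by
    calc (1 : ℝ) < (4.8729 / 9) ^ 80 * 18 ^ 17 := by norm_num
      _ < _ := by gcongr
  have h3 := Real.log_neg (by positivity) h1
  have h4 := Real.log_pos h2
  rw [Real.log_mul (by positivity) (by positivity), Real.log_pow, Real.log_pow] at h3 h4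
  push_cast at h3 h4
  have h5 : -Real.logb 18 x = -Real.log x / Real.log 18 := by
    rw [Real.logb, neg_div]
  rw [h5, abs_lt]
  constructor
  · rw [lt_sub_iff_add_lt, lt_div_iff₀ hlog18]
    linarith
  · rw [sub_lt_iff_lt_add, div_lt_iff₀ hlog18]
    linarith

end RandomQuotient

open RandomQuotient
theorem mainTheorem6 :
    IsHyperbolic gens₁ ∧ ¬ HasHarmlessTorsion gens₁ ∧
    ∃ θ₁ θ₂ : ℝ, HasGrossCogrowth gens₁ θ₁ ∧ HasGrossCogrowth gens₂ θ₂ ∧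
      1 - θ₂ = -Real.logb 18 ((1 + Real.sqrt 15) / 9) ∧
      |(1 - θ₂) - 0.212| < 0.0005 ∧
      1 - θ₂ < 1 - θ₁ ∧
      (∀ (M : Model) (d : ℝ), 1 - θ₂ < d → d ≤ 1 →
        Tendsto
          (fun ℓ : ℕ => relatorProb gens₁ d ℓ
            (fun R => (Odd ℓ ∧ IsTrivialGroup (RelQuotient R)) ∨
              (Even ℓ ∧ IsCyclicTwo (RelQuotient R))) M)
          atTop (𝓝 1)) ∧
      ∀ M : Model, ¬ PlainWordsTheoremHolds gens₁ M := by
  obtain ⟨θ₁, h₁⟩ := exists_hasGrossCogrowth gens₁ (closedCount_pos gens₁_u_mul_self)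
  obtain ⟨θ₂, h₂⟩ := exists_hasGrossCogrowth gens₂ (closedCount_pos gens₂_u_mul_self)
  have hθ₂ := h₂.eq_logb
  have hval : 1 - θ₂ = -Real.logb 18 ((1 + √15) / 9) := by rw [hθ₂, one_sub_logb_eq]
  have hnum : |(1 - θ₂) - 0.212| < 0.0005 := by
    rw [hval]
    exact abs_critical_density_sub_lt
  have hpos : 0 < 1 - θ₂ := by
    have := (abs_lt.1 hnum).1
    norm_num at this ⊢
    linarith
  have hlt : 1 - θ₂ < 1 - θ₁ := by
    have h := h₁.le_logb (closedCount_pos gens₁_u_mul_self) (c := 19 / 2)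
      fun n => closedCount_gens₁_le (2 * n)
    rw [cast_two_mul_card_genIndex] at h
    have h15 : (3.8 : ℝ) < √15 := Real.lt_sqrt_of_sq_lt (by norm_num)
    have := Real.logb_lt_logb (b := 18) (by norm_num) (by norm_num : (0 : ℝ) < 19 / 2)
      (by linarith : 19 / 2 < 2 + 2 * √15)
    linarith
  have hphase : ∀ (M : Model) (d : ℝ), 1 - θ₂ < d → d ≤ 1 →
      Tendsto (fun ℓ : ℕ => relatorProb gens₁ d ℓ
        (fun R => (Odd ℓ ∧ IsTrivialGroup (RelQuotient R)) ∨
          (Even ℓ ∧ IsCyclicTwo (RelQuotient R))) M) atTop (𝓝 1) := fun M d hd hd1 =>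
    tendsto_relatorProb_collapse M (by rwa [← hθ₂]) (hpos.le.trans hd.le) hd1
  refine ⟨isHyperbolic_gens₁, not_hasHarmlessTorsion_gens₁, θ₁, θ₂, h₁, h₂, hval, hnum, hlt,
    hphase, fun M hM => ?_⟩
  -- between the two critical densities the quotient would be both infinite and finite
  have hlt1 : 1 - θ₂ < 1 := by
    have := (abs_lt.1 hnum).2
    norm_num at this ⊢
    linarith
  obtain ⟨d, hd2, hd⟩ := exists_between (lt_min hlt hlt1)
  have hd1 := lt_min_iff.1 hd
  have hlim := ((hM θ₁ h₁ d (hpos.trans hd2) hd1.2).1 hd1.1).add (hphase M d hd2 hd1.2.le)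
  have hle : (1 : ℝ) + 1 ≤ 1 := by
    refine le_of_tendsto hlim (Eventually.of_forall fun ℓ => ?_)
    refine relatorProb_add_le_one gens₁ d ℓ (fun R hR hR' => ?_) M
    have hinf : Infinite (RelQuotient R) := hR.2.1
    rcases hR' with ⟨-, h⟩ | ⟨-, ⟨e⟩⟩
    · have : Subsingleton (RelQuotient R) := ⟨fun x y => (h x).trans (h y).symm⟩
      exact not_finite (RelQuotient R)
    · exact (Finite.of_equiv _ e.symm.toEquiv).not_infinite hinf
  norm_num at hle
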